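/- **Theorem.** Let $n\ge 1$, $0<\alpha<n$, let $r,s>1$ with $\frac1r+\frac1s=1$, let $r<p_1<\infty$, $s<p_2<\infty$, $\frac1p=\frac1{p_1}+\frac1{p_2}$, and $1<p\le q<\infty$, $q'=\frac{q}{q-1}$. For functions $f,g$ on $\mathbb R^n$ put $$\mathsf{BI}_\alpha(f,g)(x)=\int_{\mathbb R^n}\frac{f(x-y)\,g(x+y)}{|y|^{n-\alpha}}\,dy .$$ A *Young function* is a continuous, convex, nondecreasing $\Phi:[0,\infty)\to[0,\infty)$ with $\Phi(0)=0$ and $\Phi(t)/t\to\infty$ as $t\to\infty$; an *associate* of $\Phi$ is a Young function $\bar\Phi$ with $t\le\Phi^{-1}(t)\,\bar\Phi^{-1}(t)\le 2t$ for all $t>0$ (for instance the convex conjugate of $\Phi$). We write $\Phi\in B_m$ if $\int_c^\infty \Phi(t)\,t^{-m-1}\,dt<\infty$ for some $c>0$. For a cube $Q$ (with sides parallel to the axes) and measurable $w:\mathbb R^n\to[0,\infty]$ put $$\|w\|_{\Phi,Q}=\inf\Big\{\lambda>0:\ \frac1{|Q|}\int_Q\Phi\Big(\frac{w(x)}{\lambda}\Big)\,dx\le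 1\Big\},\qquad \Phi(\infty)=\infty,\ \inf\emptyset=\infty .$$ Let $\psi,\phi_1,\phi_2$ be Young functions with associates $\bar\psi\in B_{q'}$, $\bar\phi_1\in B_{p_1/r}$, $\bar\phi_2\in B_{p_2/s}$, and let $u,v_1,v_2:\mathbb R^n\to[0,\infty]$ be measurable weights with $$\sup_Q\,|Q|^{\frac\alpha n+\frac1q-\frac1p}\,\big\|u^{1/q}\big\|_{\psi,Q}\,\big\|v_1^{-r/p_1}\big\|_{\phi_1,Q}^{1/r}\,\big\|v_2^{-s/p_2}\big\|_{\phi_2,Q}^{1/s}<\infty ,$$ the supremum being over all cubes $Q$ (with $0\cdot\infty=0$). Then there is a constant $C<\infty$ such that for all real- or complex-valued $f\in L^{p_1}(v_1)$ and $g\in L^{p_2}(v_2)$ the integral defining $\mathsf{BI}_\alpha(f,g)(x)$ converges absolutely for $u\,dx$-almost every $x$, $\mathsf{BI}_\alpha(f,g)\in L^q(u)$, and $$\|\mathsf{BI}_\alpha(f,g)\|_{L^q(u)}\le C\,\|f\|_{L^{p_1}(v_1)}\,\|g\|_{L^{p_2}(v_2)} ,$$ where $\|f\|_{L^{m}(w)}=\big(\int_{\mathbb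 R^n}|f|^m\,w\,dx\big)^{1/m}$. -/

import Mathlib

open MeasureTheory Filter Set
open scoped ENNReal NNReal Topology

noncomputable section

namespace BilinearFractional

/-- Young functions `Φ : [0,∞) → [0,∞)`: continuous, convex, nondecreasing, `Φ 0 = 0`, and
`Φ t / t → ∞` as `t → ∞`. (Such a function is automatically strictly increasing where it is
positive; asking for nondecreasing rather than strictly increasing makes the class slightly larger,
and every function in the class has an associate function in the class, for example its convex
conjugate.) -/
structure IsYoungFunction (Φ : ℝ≥0 → ℝ≥0) : Prop where
  continuous : Continuous Φ
  convexOn : ConvexOn ℝ≥0 univ Φ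
  monotone : Monotone Φ
  map_zero : Φ 0 = 0
  tendsto_div : Tendsto (fun t : ℝ≥0 => Φ t / t) atTop atTop

/-- `Ψ` is an associate function of the Young function `Φ`: it is a Young function and
`t ≤ Φ⁻¹(t) Ψ⁻¹(t) ≤ 2 t` for all `t > 0`. Here `a = Φ⁻¹(t)` and `b = Ψ⁻¹(t)` are the unique
solutions of `Φ a = t` and `Ψ b = t`. -/
structure IsAssociate (Φ Ψ : ℝ≥0 → ℝ≥0) : Prop where
  isYoungFunction : IsYoungFunction Ψ
  le_mul : ∀ a b t : ℝ≥0, 0 < t → Φ a = t → Ψ b = t → t ≤ a * b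
  mul_le : ∀ a b t : ℝ≥0, 0 < t → Φ a = t → Ψ b = t → a * b ≤ 2 * t

/-- The class `B_p`: there is `c > 0` with `∫_c^∞ Φ(t) / t^(p+1) dt < ∞`. -/
def MemB (p : ℝ) (Φ : ℝ≥0 → ℝ≥0) : Prop :=
  ∃ c : ℝ, 0 < c ∧
    IntegrableOn (fun t : ℝ => (Φ t.toNNReal : ℝ) / t ^ (p + 1)) (Ioi c) volume

/-- Extension of `Φ : [0,∞) → [0,∞)` to `[0,∞]` by `Φ ∞ = ∞`. -/
def extendTop (Φ : ℝ≥0 → ℝ≥0) (x : ℝ≥0∞) : ℝ≥0∞ :=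
  if x = ∞ then ∞ else (Φ x.toNNReal : ℝ≥0∞)

/-- The (half-open, axis-parallel) cube in `ℝⁿ` with corner `a` and side length `ℓ`. -/
def cube {n : ℕ} (a : EuclideanSpace ℝ (Fin n)) (ℓ : ℝ) : Set (EuclideanSpace ℝ (Fin n)) :=
  {x | ∀ i, a i ≤ x i ∧ x i < a i + ℓ}

/-- The Orlicz average `‖f‖_{Φ,Q} = inf {c > 0 : ⨍_Q Φ(f / c) ≤ 1}` of a `[0,∞]`-valued function
(the infimum of the empty set being `∞`). -/
def orliczAvg {n : ℕ} (Φ : ℝ≥0 → ℝ≥0) (Q : Set (EuclideanSpace ℝ (Fin n)))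
    (f : EuclideanSpace ℝ (Fin n) → ℝ≥0∞) : ℝ≥0∞ :=
  ⨅ (c : ℝ≥0) (_ : 0 < c)
    (_ : ⨍⁻ x in Q, extendTop Φ (f x / (c : ℝ≥0∞)) ∂volume ≤ 1), (c : ℝ≥0∞)

/-- The integrand `f(x - y) g(x + y) / |y|^(n - α)`. -/
def biKernel {𝕜 : Type*} [RCLike 𝕜] {n : ℕ} (α : ℝ) (f g : EuclideanSpace ℝ (Fin n) → 𝕜)
    (x y : EuclideanSpace ℝ (Fin n)) : 𝕜 :=
  f (x - y) * g (x + y) / ((‖y‖ ^ ((n : ℝ) - α) : ℝ) : 𝕜)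

/-- The bilinear fractional integral `BI_α(f, g)(x) = ∫ f(x - y) g(x + y) / |y|^(n - α) dy`. -/
def BI {𝕜 : Type*} [RCLike 𝕜] {n : ℕ} (α : ℝ) (f g : EuclideanSpace ℝ (Fin n) → 𝕜)
    (x : EuclideanSpace ℝ (Fin n)) : 𝕜 :=
  ∫ y, biKernel α f g x y ∂volume

/-- The two-weight Orlicz bump constant
`sup_Q |Q|^(α/n + 1/q - 1/p) ‖u^(1/q)‖_{ψ,Q} ‖v₁^(-r/p₁)‖_{φ₁,Q}^(1/r) ‖v₂^(-s/p₂)‖_{φ₂,Q}^(1/s)`,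
the supremum being over all cubes. -/
def bumpConstant {n : ℕ} (α p p₁ p₂ q r s : ℝ) (ψ φ₁ φ₂ : ℝ≥0 → ℝ≥0)
    (u v₁ v₂ : EuclideanSpace ℝ (Fin n) → ℝ≥0∞) : ℝ≥0∞ :=
  ⨆ (a : EuclideanSpace ℝ (Fin n)) (ℓ : ℝ) (_ : 0 < ℓ),
    volume (cube a ℓ) ^ (α / n + 1 / q - 1 / p)
      * orliczAvg ψ (cube a ℓ) (fun x => u x ^ (1 / q))
      * orliczAvg φ₁ (cube a ℓ) (fun x => v₁ x ^ (-(r / p₁))) ^ (1 / r)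
      * orliczAvg φ₂ (cube a ℓ) (fun x => v₂ x ^ (-(s / p₂))) ^ (1 / s)

end BilinearFractional

end

/-! Taking absolute values reduces everything to the positive operator `lBI`. For `|y| ~ 2^k` the
kernel is essentially constant, and Hölder's inequality in `y` with exponents `r, s` decouples the
two factors. Both `x - y` and `x + y` lie in a ball around `x`, which by the one-third trick sits
inside a cube of comparable size from one of `2^n` dyadic grids. Hence (`lBI_le_tsum`) the operator
is dominated by finitely many dyadic sums of `|Q|^(α/n) ⟨F^r⟩_Q^(1/r) ⟨G^s⟩_Q^(1/s)` over the cubes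
`Q` containing `x`.

Each dyadic sum is paired with a function `u^(1/q) h`, `h ∈ L^(q')`. Since `α > 0`, the factors
`|Q|^(α/n)` along a descending chain of cubes sum geometrically, so only the cubes at which the
product of averages jumps by a factor larger than 4 matter. These stopping cubes are sparse: at
least half of each is free of later ones, and the free parts are pairwise disjoint
(`IsGrid.setLIntegral_stopSet_le`). On a single cube, Hölder's inequality for Orlicz averages and
the bump condition replace the three averages by `|Q|^(1/p - 1/q)` times Orlicz averages of `h`,
`F^r v₁^(r/p₁)` and `G^s v₂^(s/p₂)` for the associate Young functions
(`volume_rpow_mul_laverage_le`).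

On the disjoint parts those averages are at most the corresponding Orlicz maximal functions, which
the `B` conditions make bounded on `L^(q')`, `L^(p₁/r)` and `L^(p₂/s)`
(`IsYoungFunction.exists_lintegral_iSup_cellOrlicz_le`). A Chebyshev interpolation absorbs `|Q|^(1/p
- 1/q)`, two applications of Hölder finish the sum (`IsGrid.tsum_lintegral_le`), and duality gives
the `L^q` bound. Weights taking the values `0` and `∞` are treated separately: outside trivial cases
the bump condition forces `v₁, v₂ > 0` almost everywhere. -/

noncomputable section

namespace BilinearFractional

/-! ### Young functions, Orlicz averages and the `B_m` integral. -/

section Orlicz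

variable {Φ Ψ : ℝ≥0 → ℝ≥0} {n : ℕ}

theorem IsYoungFunction.exists_le_add (hΦ : IsYoungFunction Φ) : ∃ T, ∀ t, t ≤ T + Φ t := by
  obtain ⟨T, hT⟩ := eventually_atTop.1 (hΦ.tendsto_div.eventually_ge_atTop 1)
  refine ⟨T, fun t => ?_⟩
  rcases le_total t T with h | h
  · exact h.trans le_self_add
  · rcases eq_or_ne t 0 with rfl | h0
    · simp
    · have := hT t h
      rw [one_le_div (pos_iff_ne_zero.2 h0)] at this
      exact this.trans le_add_self

theorem IsYoungFunction.surjective (hΦ : IsYoungFunction Φ) : Function.Surjective Φ := by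
  intro t
  obtain ⟨T, hT⟩ := hΦ.exists_le_add
  have h1 : t ≤ Φ (T + t) := by
    have := hT (T + t)
    exact le_of_add_le_add_left this
  have := intermediate_value_Icc (zero_le (a := T + t)) hΦ.continuous.continuousOn
  obtain ⟨a, -, ha⟩ := this (show t ∈ Icc (Φ 0) (Φ (T + t)) from ⟨by simp [hΦ.map_zero], h1⟩)
  exact ⟨a, ha⟩

theorem IsAssociate.mul_le_of_le (hΦ : IsYoungFunction Φ) (h : IsAssociate Φ Ψ) {a b t : ℝ≥0}
    (ht : 0 < t) (ha : Φ a ≤ t) (hb : Ψ b ≤ t) : a * b ≤ 2 * t := by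
  -- enlarge `a` and `b` to preimages of `t`
  have key : ∀ {Θ : ℝ≥0 → ℝ≥0}, IsYoungFunction Θ → ∀ {c}, Θ c ≤ t → ∃ d, c ≤ d ∧ Θ d = t := by
    intro Θ hΘ c hc
    obtain ⟨d, hd⟩ := hΘ.surjective t
    rcases le_total c d with h | h
    · exact ⟨d, h, hd⟩
    · exact ⟨c, le_rfl, le_antisymm hc (hd ▸ hΘ.monotone h)⟩
  obtain ⟨a', haa, ha'⟩ := key hΦ ha
  obtain ⟨b', hbb, hb'⟩ := key h.isYoungFunction hb
  exact (mul_le_mul' haa hbb).trans (h.mul_le a' b' t ht ha' hb')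

/-- Young's inequality up to a factor: `a` and `b` both lie below the preimages of the single value
`t = Φ a + Ψ b`. The `ε` only makes this value positive. -/
theorem IsAssociate.young (hΦ : IsYoungFunction Φ) (h : IsAssociate Φ Ψ) (a b : ℝ≥0) :
    a * b ≤ 2 * (Φ a + Ψ b) := by
  refine le_of_forall_pos_le_add fun ε hε => ?_
  have := h.mul_le_of_le hΦ (a := a) (b := b) (t := Φ a + Ψ b + ε / 2) (by positivity)
    (by rw [add_assoc]; exact le_self_add) (by rw [add_right_comm]; exact le_add_self)
  refine this.trans (le_of_eq ?_)
  rw [mul_add, mul_div_cancel₀ _ (by norm_num)]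

@[simp] theorem extendTop_coe (Φ : ℝ≥0 → ℝ≥0) (x : ℝ≥0) : extendTop Φ x = Φ x := by
  simp [extendTop]

@[simp] theorem extendTop_top (Φ : ℝ≥0 → ℝ≥0) : extendTop Φ ∞ = ∞ := by
  simp [extendTop]

theorem measurable_extendTop (hΦ : Measurable Φ) : Measurable (extendTop Φ) := by
  unfold extendTop
  refine Measurable.ite (measurableSet_singleton ∞) measurable_const ?_
  exact (hΦ.comp ENNReal.measurable_toNNReal).coe_nnreal_ennreal

theorem extendTop_mono (hΦ : Monotone Φ) : Monotone (extendTop Φ) := by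
  intro x y hxy
  induction y with
  | top => simp
  | coe y =>
    lift x to ℝ≥0 using ne_top_of_le_ne_top ENNReal.coe_ne_top hxy
    simpa using hΦ (by exact_mod_cast hxy)

theorem IsAssociate.extendTop_young (hΦ : IsYoungFunction Φ) (h : IsAssociate Φ Ψ) (x y : ℝ≥0∞) :
    x * y ≤ 2 * (extendTop Φ x + extendTop Ψ y) := by
  induction x with
  | top => simp [ENNReal.mul_top]
  | coe x =>
    induction y with
    | top => simp [ENNReal.mul_top]
    | coe y => simpa using mod_cast h.young hΦ x y

theorem exists_of_orliczAvg_lt {Q : Set (EuclideanSpace ℝ (Fin n))}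
    {f : EuclideanSpace ℝ (Fin n) → ℝ≥0∞} {b : ℝ≥0∞} (h : orliczAvg Φ Q f < b) :
    ∃ c : ℝ≥0, 0 < c ∧ (c : ℝ≥0∞) < b ∧
      ⨍⁻ x in Q, extendTop Φ (f x / (c : ℝ≥0∞)) ∂volume ≤ 1 := by
  simp only [orliczAvg, iInf_lt_iff] at h
  obtain ⟨c, hc, h1, h2⟩ := h
  exact ⟨c, hc, h2, h1⟩

theorem one_lt_of_lt_orliczAvg {Q : Set (EuclideanSpace ℝ (Fin n))}
    {f : EuclideanSpace ℝ (Fin n) → ℝ≥0∞} {c : ℝ≥0} (hc : 0 < c)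
    (h : (c : ℝ≥0∞) < orliczAvg Φ Q f) :
    1 < ⨍⁻ x in Q, extendTop Φ (f x / (c : ℝ≥0∞)) ∂volume := by
  by_contra! h'
  exact absurd h (not_lt.2 (iInf_le_of_le c (iInf_le_of_le hc (iInf_le_of_le h' le_rfl))))

theorem orliczAvg_congr {Q : Set (EuclideanSpace ℝ (Fin n))}
    {f g : EuclideanSpace ℝ (Fin n) → ℝ≥0∞} (h : f =ᵐ[volume] g) :
    orliczAvg Φ Q f = orliczAvg Φ Q g := by
  unfold orliczAvg
  have : ∀ c : ℝ≥0, ⨍⁻ x in Q, extendTop Φ (f x / (c : ℝ≥0∞)) ∂volume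
      = ⨍⁻ x in Q, extendTop Φ (g x / (c : ℝ≥0∞)) ∂volume := fun c =>
    laverage_congr (ae_restrict_of_ae (h.mono fun x hx => by simp only [hx]))
  simp only [this]

/-- The average of a function is bounded by a multiple of its Orlicz average. -/
theorem IsYoungFunction.exists_laverage_le (hΦ : IsYoungFunction Φ) :
    ∃ K : ℝ≥0, ∀ (Q : Set (EuclideanSpace ℝ (Fin n))) (f : EuclideanSpace ℝ (Fin n) → ℝ≥0∞),
      volume Q ≠ 0 → volume Q ≠ ∞ → Measurable f →
      ⨍⁻ x in Q, f x ∂volume ≤ K * orliczAvg Φ Q f := by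
  obtain ⟨T, hT⟩ := hΦ.exists_le_add
  -- For an admissible `c`, the average of `T + Φ(f / c)` is at most `T + 1`.
  refine ⟨T + 1, fun Q f h0 h1 hf => ?_⟩
  have hT' : ∀ x : ℝ≥0∞, x ≤ T + extendTop Φ x := by
    intro x
    induction x with
    | top => simp
    | coe x => simpa using mod_cast hT x
  have hK : ((T + 1 : ℝ≥0) : ℝ≥0∞) ≠ 0 := by simp
  rw [mul_comm, ← ENNReal.div_le_iff hK ENNReal.coe_ne_top]
  refine le_of_forall_gt fun b hb => ?_
  obtain ⟨c, hc, hcb, hc1⟩ := exists_of_orliczAvg_lt hb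
  refine lt_of_le_of_lt ?_ hcb
  rw [ENNReal.div_le_iff hK ENNReal.coe_ne_top]
  have hc0 : (c : ℝ≥0∞) ≠ 0 := by exact_mod_cast hc.ne'
  have := NeZero.mk (show volume.restrict Q ≠ 0 by simpa [Measure.restrict_eq_zero] using h0)
  have : IsFiniteMeasure (volume.restrict Q) := ⟨by simpa using h1.lt_top⟩
  calc ⨍⁻ x in Q, f x ∂volume ≤ ⨍⁻ x in Q, c * (T + extendTop Φ (f x / c)) ∂volume := by
        refine lintegral_mono fun x => ?_
        refine le_trans ?_ (mul_le_mul_right (hT' (f x / c)) _)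
        rw [ENNReal.mul_div_cancel hc0 ENNReal.coe_ne_top]
    _ = c * (T + ⨍⁻ x in Q, extendTop Φ (f x / c) ∂volume) := by
        simp only [laverage]
        rw [lintegral_const_mul' _ _ ENNReal.coe_ne_top, lintegral_add_left measurable_const]
        have := laverage_const (volume.restrict Q) (T : ℝ≥0∞)
        rw [laverage] at this
        rw [this]
    _ ≤ c * ((T + 1 : ℝ≥0) : ℝ≥0∞) := by
        push_cast
        gcongr

/-- Hölder's inequality for Orlicz averages. -/
theorem IsAssociate.laverage_mul_le (hΦ : IsYoungFunction Φ) (h : IsAssociate Φ Ψ)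
    {Q : Set (EuclideanSpace ℝ (Fin n))} {f g : EuclideanSpace ℝ (Fin n) → ℝ≥0∞}
    (hf : Measurable f) (h0 : orliczAvg Φ Q f ≠ 0) (h1 : orliczAvg Φ Q f ≠ ∞) :
    ⨍⁻ x in Q, f x * g x ∂volume ≤ 4 * orliczAvg Φ Q f * orliczAvg Ψ Q g := by
  -- The 4 is the factor 2 of Young's inequality times the two averages, each at most 1. The rest of
  -- the proof passes to the infimum over `d`, then over `c`.
  have key : ∀ c d : ℝ≥0, 0 < c → 0 < d →
      ⨍⁻ x in Q, extendTop Φ (f x / (c : ℝ≥0∞)) ∂volume ≤ 1 →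
      ⨍⁻ x in Q, extendTop Ψ (g x / (d : ℝ≥0∞)) ∂volume ≤ 1 →
      ⨍⁻ x in Q, f x * g x ∂volume ≤ 4 * c * d := by
    intro c d hc hd hfc hgd
    have hc0 : (c : ℝ≥0∞) ≠ 0 := by exact_mod_cast hc.ne'
    have hd0 : (d : ℝ≥0∞) ≠ 0 := by exact_mod_cast hd.ne'
    calc ⨍⁻ x in Q, f x * g x ∂volume
        ≤ ⨍⁻ x in Q, (2 * c * d) * (extendTop Φ (f x / c) + extendTop Ψ (g x / d)) ∂volume := by
          refine lintegral_mono fun x => ?_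
          calc f x * g x = (c * d) * ((f x / c) * (g x / d)) := by
                rw [mul_mul_mul_comm, ENNReal.mul_div_cancel hc0 ENNReal.coe_ne_top,
                  ENNReal.mul_div_cancel hd0 ENNReal.coe_ne_top]
            _ ≤ (c * d) * (2 * (extendTop Φ (f x / c) + extendTop Ψ (g x / d))) := by
                exact mul_le_mul_right (h.extendTop_young hΦ _ _) _
            _ = _ := by ring
      _ = (2 * c * d) * (⨍⁻ x in Q, extendTop Φ (f x / c) ∂volume
            + ⨍⁻ x in Q, extendTop Ψ (g x / d) ∂volume) := by
          simp only [laverage]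
          rw [lintegral_const_mul' _ _ (by finiteness), lintegral_add_left]
          exact (measurable_extendTop hΦ.continuous.measurable).comp (hf.div_const _)
      _ ≤ (2 * c * d) * (1 + 1) := by gcongr
      _ = 4 * c * d := by ring
  have h4 : 4 * orliczAvg Φ Q f ≠ 0 := by simp [h0]
  have h4' : 4 * orliczAvg Φ Q f ≠ ∞ := by finiteness
  rw [mul_comm, ← ENNReal.div_le_iff h4 h4']
  refine le_of_forall_gt fun b hb => ?_
  obtain ⟨d, hd, hdb, hd1⟩ := exists_of_orliczAvg_lt hb
  refine lt_of_le_of_lt ?_ hdb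
  rw [ENNReal.div_le_iff h4 h4', ← mul_assoc]
  have hd0 : (d : ℝ≥0∞) * 4 ≠ 0 := by simp [hd.ne']
  have hd0' : (d : ℝ≥0∞) * 4 ≠ ∞ := by finiteness
  rw [mul_comm, ← ENNReal.div_le_iff hd0 hd0']
  refine le_of_forall_gt fun b hb => ?_
  obtain ⟨c, hc, hcb, hc1⟩ := exists_of_orliczAvg_lt hb
  refine lt_of_le_of_lt ?_ hcb
  rw [ENNReal.div_le_iff hd0 hd0']
  exact (key c d hc hd hc1 hd1).trans (le_of_eq (by ring))

/-- Provides the truncation level for the weak type inequality: where `w ≤ c t`, the function `Φ(w /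
t)` contributes at most one half to an average. -/
theorem IsYoungFunction.exists_pos_le_half (hΦ : IsYoungFunction Φ) :
    ∃ c : ℝ≥0, 0 < c ∧ Φ c ≤ 1 / 2 := by
  have : ∀ᶠ x in 𝓝 (0 : ℝ≥0), Φ x < 1 / 2 :=
    hΦ.continuous.continuousAt.eventually_lt_const (by simp [hΦ.map_zero])
  obtain ⟨ε, hε, h⟩ := Metric.eventually_nhds_iff.1 this
  lift ε to ℝ≥0 using hε.le
  have hε' : 0 < ε := by exact_mod_cast hε
  refine ⟨ε / 2, by positivity, (h ?_).le⟩
  rw [NNReal.dist_eq]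
  have h2 : |(ε : ℝ) / 2| < ε := by rw [abs_of_pos (half_pos hε)]; exact half_lt_self hε
  simpa using h2

/-- The integrand is continuous away from 0, so the lower limit in the definition of `B_m` is
immaterial. -/
theorem MemB.integrableOn {m : ℝ} (hm : MemB m Φ) (hΦ : Continuous Φ) {c : ℝ} (hc : 0 < c) :
    IntegrableOn (fun t : ℝ => (Φ t.toNNReal : ℝ) / t ^ (m + 1)) (Ioi c) volume := by
  obtain ⟨d, hd, h⟩ := hm
  have h1 : IntegrableOn (fun t : ℝ => (Φ t.toNNReal : ℝ) / t ^ (m + 1)) (Icc c d) volume := by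
    refine ContinuousOn.integrableOn_Icc ?_
    refine ContinuousOn.div (by fun_prop) ?_ ?_
    · intro x hx
      exact (Real.continuousAt_rpow_const _ _ (Or.inl (hc.trans_le hx.1).ne')).continuousWithinAt
    · intro x hx
      exact (Real.rpow_pos_of_pos (hc.trans_le hx.1) _).ne'
  refine (h1.union h).mono_set ?_
  intro x hx
  rcases le_or_gt x d with h | h
  · exact Or.inl ⟨le_of_lt hx, h⟩
  · exact Or.inr h

/-- The substitution `t ↦ w / t` carries `(c, ∞)` onto `(0, w / c)`, which turns the layer cake
integral at height `w` into the `B_m` integral. -/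
theorem lintegral_young_scale {m : ℝ} {c : ℝ} (hc : 0 < c) {w : ℝ} (hw : 0 < w) :
    ∫⁻ t in Ioo 0 (w / c), ENNReal.ofReal (t ^ (m - 1) * Φ (w / t).toNNReal)
      = ENNReal.ofReal (w ^ m) *
        ∫⁻ t in Ioi c, ENNReal.ofReal ((Φ t.toNNReal : ℝ) / t ^ (m + 1)) := by
  have him : (fun t : ℝ => w / t) '' Ioi c = Ioo 0 (w / c) := by
    ext y
    constructor
    · rintro ⟨t, ht, rfl⟩
      have ht0 : 0 < t := hc.trans ht
      exact ⟨by positivity, div_lt_div_of_pos_left hw hc ht⟩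
    · rintro ⟨h0, h1⟩
      refine ⟨w / y, ?_, by field_simp⟩
      rw [mem_Ioi, lt_div_iff₀ h0, mul_comm]
      exact (lt_div_iff₀ hc).1 h1
  rw [← him, lintegral_image_eq_lintegral_abs_deriv_mul (f' := fun t => -(w / t ^ 2))
    measurableSet_Ioi, ← lintegral_const_mul' _ _ ENNReal.ofReal_ne_top]
  · refine setLIntegral_congr_fun measurableSet_Ioi fun t ht => ?_
    have ht0 : 0 < t := hc.trans ht
    rw [← ENNReal.ofReal_mul (abs_nonneg _), ← ENNReal.ofReal_mul (by positivity)]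
    congr 1
    have h1 : w / (w / t) = t := by field_simp
    rw [h1, abs_neg, abs_of_pos (by positivity), Real.div_rpow hw.le ht0.le,
      Real.rpow_sub_one hw.ne', Real.rpow_sub_one ht0.ne', Real.rpow_add_one ht0.ne']
    have := (Real.rpow_pos_of_pos ht0 m).ne'
    field_simp
  · intro t ht
    have ht0 : 0 < t := hc.trans ht
    have := ((hasDerivAt_inv ht0.ne').const_mul w).hasDerivWithinAt (s := Ioi c)
    simpa [div_eq_mul_inv] using this
  · intro a ha b hb hab
    have ha0 : 0 < a := hc.trans ha
    have hb0 : 0 < b := hc.trans hb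
    simp only at hab
    rw [div_eq_div_iff ha0.ne' hb0.ne'] at hab
    exact (mul_left_cancel₀ hw.ne' hab).symm

/-- This is where `B_m` enters: after Fubini, it is the inner integral in the strong type bound for
the Orlicz maximal function. -/
theorem MemB.exists_lintegral_le {m : ℝ} (hm0 : 0 < m) (hm : MemB m Φ) (hΦ : Continuous Φ)
    {c : ℝ≥0} (hc : 0 < c) :
    ∃ C : ℝ≥0, ∀ w : ℝ≥0∞, ∫⁻ t in Ioi (0 : ℝ), ENNReal.ofReal (t ^ (m - 1)) *
      (if c * ENNReal.ofReal t < w then extendTop Φ (w / ENNReal.ofReal t) else 0) ≤ C * w ^ m := by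
  set I := ∫⁻ t in Ioi (c : ℝ), ENNReal.ofReal ((Φ t.toNNReal : ℝ) / t ^ (m + 1)) with hI
  have hIt : I ≠ ∞ := by
    have := (hm.integrableOn hΦ (c := c) (by exact_mod_cast hc)).lintegral_lt_top
    exact this.ne
  -- The added 1 keeps the constant positive, so that the right side is `∞` when `w = ∞`.
  refine ⟨I.toNNReal + 1, fun w => ?_⟩
  rw [ENNReal.coe_add, ENNReal.coe_toNNReal hIt, ENNReal.coe_one]
  induction w with
  | top => simp [ENNReal.top_rpow_of_pos hm0, ENNReal.mul_top]
  | coe w =>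
    rcases eq_or_ne w 0 with rfl | hw
    · simp
    have hw0 : 0 < w := pos_iff_ne_zero.2 hw
    have hcR : (0 : ℝ) < c := by exact_mod_cast hc
    have hwR : (0 : ℝ) < w := by exact_mod_cast hw0
    calc _ = ∫⁻ t in Ioi (0 : ℝ), (Ioo (0 : ℝ) (w / c)).indicator (fun t => ENNReal.ofReal
            (t ^ (m - 1) * Φ ((w : ℝ) / t).toNNReal)) t := by
          refine setLIntegral_congr_fun measurableSet_Ioi fun t ht => ?_
          have ht0 : (0 : ℝ) < t := ht
          have hiff : (c * ENNReal.ofReal t < (w : ℝ≥0∞)) ↔ t ∈ Ioo (0 : ℝ) (w / c) := by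
            rw [ENNReal.ofReal, ← ENNReal.coe_mul, ENNReal.coe_lt_coe, ← NNReal.coe_lt_coe,
              NNReal.coe_mul, Real.coe_toNNReal _ ht0.le, mem_Ioo, lt_div_iff₀ hcR, mul_comm]
            simp [ht0]
          by_cases h : t ∈ Ioo (0 : ℝ) (w / c)
          · rw [indicator_of_mem h, if_pos (hiff.2 h), ENNReal.ofReal_mul (by positivity)]
            congr 1
            rw [ENNReal.ofReal, ← ENNReal.coe_div (by simpa using ht0), extendTop_coe,
              ENNReal.ofReal, Real.toNNReal_coe, Real.toNNReal_div hwR.le, Real.toNNReal_coe]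
          · rw [indicator_of_notMem h, if_neg (fun h' => h (hiff.1 h')), mul_zero]
      _ ≤ ∫⁻ t in Ioo (0 : ℝ) (w / c), ENNReal.ofReal
            (t ^ (m - 1) * Φ ((w : ℝ) / t).toNNReal) := by
          refine (setLIntegral_le_lintegral _ _).trans ?_
          rw [lintegral_indicator measurableSet_Ioo]
      _ = ENNReal.ofReal ((w : ℝ) ^ m) * I := lintegral_young_scale hcR hwR
      _ ≤ (I + 1) * (w : ℝ≥0∞) ^ m := by
          rw [← ENNReal.ofReal_rpow_of_pos hwR, ENNReal.ofReal_coe_nnreal, mul_comm]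
          gcongr
          exact le_self_add

end Orlicz

/-! ### Nested countable partitions and averages over their cells. -/

/-- The cell of index `i` of the `j`-th partition. -/
def cell {X ι : Type*} (π : ℕ → X → ι) (j : ℕ) (i : ι) : Set X := π j ⁻¹' {i}

/-- A sequence of finer and finer measurable partitions into cells of positive finite measure,
the cells of the `j`-th partition being the fibres of `π j`. -/
structure IsGrid {X ι : Type*} [MeasurableSpace X] [MeasurableSpace ι] (μ : Measure X)
    (π : ℕ → X → ι) : Prop where
  measurable : ∀ j, Measurable (π j)
  nested : ∀ j x y, π (j + 1) x = π (j + 1) y → π j x = π j y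
  ne_zero : ∀ j x, μ (cell π j (π j x)) ≠ 0
  ne_top : ∀ j x, μ (cell π j (π j x)) ≠ ∞

/-- `R` is a union of cells of the `j`-th partition. -/
def Saturated {X ι : Type*} (π : ℕ → X → ι) (j : ℕ) (R : Set X) : Prop :=
  ∀ x y, π j x = π j y → x ∈ R → y ∈ R

/-- The average of `f` over the cell of the `j`-th partition containing `x`. -/
def cellAvg {X ι : Type*} [MeasurableSpace X] (μ : Measure X) (π : ℕ → X → ι) (j : ℕ)
    (f : X → ℝ≥0∞) (x : X) : ℝ≥0∞ := ⨍⁻ y in cell π j (π j x), f y ∂μ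

section Grid

variable {X ι : Type*} [MeasurableSpace X] [MeasurableSpace ι] [Countable ι]
  [MeasurableSingletonClass ι] {μ : Measure X} {π : ℕ → X → ι}

omit [MeasurableSpace X] [MeasurableSpace ι] [Countable ι] [MeasurableSingletonClass ι] in
@[simp] theorem mem_cell {j : ℕ} {i : ι} {x : X} : x ∈ cell π j i ↔ π j x = i := Iff.rfl

omit [Countable ι] [MeasurableSingletonClass ι] in
theorem IsGrid.nested_le (hπ : IsGrid μ π) {j l : ℕ} (hjl : j ≤ l) {x y : X}
    (h : π l x = π l y) : π j x = π j y := by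
  induction l, hjl using Nat.le_induction with
  | base => exact h
  | succ l _ ih => exact ih (hπ.nested l x y h)

omit [Countable ι] [MeasurableSingletonClass ι] in
theorem IsGrid.saturated_mono (hπ : IsGrid μ π) {j l : ℕ} (hjl : j ≤ l) {R : Set X}
    (h : Saturated π j R) : Saturated π l R :=
  fun x y hxy hx => h x y (hπ.nested_le hjl hxy) hx

omit [Countable ι] in
theorem IsGrid.measurableSet_cell (hπ : IsGrid μ π) (j : ℕ) (i : ι) :
    MeasurableSet (cell π j i) := hπ.measurable j (measurableSet_singleton i)

omit [Countable ι] [MeasurableSingletonClass ι] in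
theorem IsGrid.cell_subset (hπ : IsGrid μ π) {j l : ℕ} (hjl : j ≤ l) (x : X) :
    cell π l (π l x) ⊆ cell π j (π j x) := fun _ hy => hπ.nested_le hjl hy

theorem IsGrid.measurable_of_const (hπ : IsGrid μ π) {j : ℕ} {β : Type*} [MeasurableSpace β]
    {c : X → β} (hc : ∀ x y, π j x = π j y → c x = c y) : Measurable c := by
  rcases isEmpty_or_nonempty X with h | h
  · exact measurable_of_empty c
  have : c = (fun i => c (Function.invFun (π j) i)) ∘ π j := by
    ext x
    refine hc _ _ ?_
    exact (Function.invFun_eq (f := π j) ⟨x, rfl⟩).symm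
  rw [this]
  exact (Measurable.of_discrete).comp (hπ.measurable j)

theorem IsGrid.measurableSet_of_saturated (hπ : IsGrid μ π) {j : ℕ} {R : Set X}
    (hR : Saturated π j R) : MeasurableSet R :=
  measurableSet_setOfPred.2 (hπ.measurable_of_const (j := j) (c := fun x => x ∈ R)
    fun x y h => propext ⟨hR x y h, hR y x h.symm⟩)

omit [MeasurableSpace ι] [Countable ι] [MeasurableSingletonClass ι] in
theorem cellAvg_congr {j : ℕ} {f : X → ℝ≥0∞} {x y : X} (h : π j x = π j y) :
    cellAvg μ π j f x = cellAvg μ π j f y := by rw [cellAvg, cellAvg, h]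

omit [Countable ι] [MeasurableSingletonClass ι] in
theorem IsGrid.cellAvg_mul (hπ : IsGrid μ π) (j : ℕ) (f : X → ℝ≥0∞) (x : X) :
    cellAvg μ π j f x * μ (cell π j (π j x)) = ∫⁻ y in cell π j (π j x), f y ∂μ := by
  rw [cellAvg, setLAverage_eq, ENNReal.div_mul_cancel (hπ.ne_zero j x) (hπ.ne_top j x)]

theorem IsGrid.lintegral_eq_tsum (hπ : IsGrid μ π) (j : ℕ) (f : X → ℝ≥0∞) :
    ∫⁻ x, f x ∂μ = ∑' i, ∫⁻ x in cell π j i, f x ∂μ := by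
  rw [← lintegral_iUnion (hπ.measurableSet_cell j)]
  · have : ⋃ i, cell π j i = univ := by ext x; simp
    rw [this, setLIntegral_univ]
  · intro a b hab
    refine Set.disjoint_left.2 fun x hx hy => hab ?_
    rw [mem_cell] at hx hy
    exact hx.symm.trans hy

/-- A cell either lies in the saturated set or misses it, so the cellwise comparison can be summed.
-/
theorem IsGrid.setLIntegral_le (hπ : IsGrid μ π) {j : ℕ} {R : Set X} (hR : Saturated π j R)
    {f g : X → ℝ≥0∞}
    (h : ∀ x ∈ R, ∫⁻ y in cell π j (π j x), f y ∂μ ≤ ∫⁻ y in cell π j (π j x), g y ∂μ) :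
    ∫⁻ x in R, f x ∂μ ≤ ∫⁻ x in R, g x ∂μ := by
  have hRm := hπ.measurableSet_of_saturated hR
  rw [← lintegral_indicator hRm, ← lintegral_indicator hRm, hπ.lintegral_eq_tsum j,
    hπ.lintegral_eq_tsum j]
  refine ENNReal.tsum_le_tsum fun i => ?_
  by_cases hi : ∃ x ∈ R, π j x = i
  · obtain ⟨x, hx, rfl⟩ := hi
    have key : ∀ k : X → ℝ≥0∞, ∫⁻ y in cell π j (π j x), R.indicator k y ∂μ
        = ∫⁻ y in cell π j (π j x), k y ∂μ := fun k =>
      setLIntegral_congr_fun (hπ.measurableSet_cell j _) fun y hy =>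
        indicator_of_mem (hR x y (mem_cell.1 hy).symm hx) _
    rw [key, key]
    exact h x hx
  · push Not at hi
    rw [setLIntegral_congr_fun (hπ.measurableSet_cell j _) (g := fun _ => 0) fun y hy =>
      indicator_of_notMem (fun hyR => hi y hyR hy) _, lintegral_zero]
    exact zero_le

/-- A covering principle: a comparison of integrals over cells, possibly of different partitions,
passes to the union of these cells. -/
theorem IsGrid.lintegral_iUnion_le (hπ : IsGrid μ π) {V : ℕ → Set X}
    (hV : ∀ j, Saturated π j (V j)) {f g : X → ℝ≥0∞}
    (h : ∀ j, ∀ x ∈ V j,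
      ∫⁻ y in cell π j (π j x), f y ∂μ ≤ ∫⁻ y in cell π j (π j x), g y ∂μ) :
    ∫⁻ x in ⋃ j, V j, f x ∂μ ≤ ∫⁻ x in ⋃ j, V j, g x ∂μ := by
  have hm : ∀ j, MeasurableSet (V j) := fun j => hπ.measurableSet_of_saturated (hV j)
  -- Disjointing assigns each point to the first `j` with `x ∈ V j`, which selects the maximal
  -- cells. The `j`-th piece is still a union of cells of level `j`, because unions of coarser cells
  -- are saturated at level `j` too.
  rw [← iUnion_disjointed, lintegral_iUnion (MeasurableSet.disjointed hm) (disjoint_disjointed V),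
    lintegral_iUnion (MeasurableSet.disjointed hm) (disjoint_disjointed V)]
  refine ENNReal.tsum_le_tsum fun j => hπ.setLIntegral_le ?_
    fun x hx => h j x (disjointed_subset V j hx)
  intro x y hxy hx
  rw [disjointed_eq_inter_compl] at hx ⊢
  refine ⟨hV j x y hxy hx.1, ?_⟩
  simp only [mem_inter_iff, mem_iInter, mem_compl_iff] at hx ⊢
  exact fun i hi hy => hx.2 i hi (hπ.saturated_mono hi.le (hV i) y x hxy.symm hy)

/-- Averaging over cells is a conditional expectation: against a function that is constant on cells,
`f` may be replaced by its averages. -/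
theorem IsGrid.setLIntegral_mul_cellAvg (hπ : IsGrid μ π) {j : ℕ} {R : Set X}
    (hR : Saturated π j R) {c f : X → ℝ≥0∞} (hf : Measurable f)
    (hc : ∀ x y, π j x = π j y → c x = c y) :
    ∫⁻ x in R, c x * f x ∂μ = ∫⁻ x in R, c x * cellAvg μ π j f x ∂μ := by
  have key : ∀ x, ∫⁻ y in cell π j (π j x), c y * f y ∂μ
      = ∫⁻ y in cell π j (π j x), c y * cellAvg μ π j f y ∂μ := by
    intro x
    calc _ = ∫⁻ y in cell π j (π j x), c x * f y ∂μ :=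
          setLIntegral_congr_fun (hπ.measurableSet_cell j _) fun y hy => by
            simp only [hc y x (mem_cell.1 hy)]
      _ = ∫⁻ y in cell π j (π j x), c x * cellAvg μ π j f x ∂μ := by
          rw [lintegral_const_mul _ hf, ← hπ.cellAvg_mul, setLIntegral_const, mul_assoc]
      _ = _ := setLIntegral_congr_fun (hπ.measurableSet_cell j _) fun y hy => by
            simp only [hc y x (mem_cell.1 hy), cellAvg_congr (mem_cell.1 hy)]
  exact le_antisymm (hπ.setLIntegral_le hR fun x _ => (key x).le)
    (hπ.setLIntegral_le hR fun x _ => (key x).ge)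

end Grid

/-! ### Boundedness of the Orlicz maximal function of a grid. -/

section Maximal

variable {Φ : ℝ≥0 → ℝ≥0} {n : ℕ} {ι : Type*} [MeasurableSpace ι] [Countable ι]
  [MeasurableSingletonClass ι] {π : ℕ → EuclideanSpace ℝ (Fin n) → ι}

/-- The Orlicz average of `w` over the cell of the `j`-th partition containing `x`. -/
def cellOrlicz (Φ : ℝ≥0 → ℝ≥0) (π : ℕ → EuclideanSpace ℝ (Fin n) → ι) (j : ℕ)
    (w : EuclideanSpace ℝ (Fin n) → ℝ≥0∞) (x : EuclideanSpace ℝ (Fin n)) : ℝ≥0∞ :=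
  orliczAvg Φ (cell π j (π j x)) w

omit [MeasurableSpace ι] [Countable ι] [MeasurableSingletonClass ι] in
theorem cellOrlicz_congr {j : ℕ} {w : EuclideanSpace ℝ (Fin n) → ℝ≥0∞}
    {x y : EuclideanSpace ℝ (Fin n)} (h : π j x = π j y) :
    cellOrlicz Φ π j w x = cellOrlicz Φ π j w y := by rw [cellOrlicz, cellOrlicz, h]

theorem IsGrid.measurable_cellOrlicz (hπ : IsGrid volume π) (j : ℕ)
    (w : EuclideanSpace ℝ (Fin n) → ℝ≥0∞) : Measurable (cellOrlicz Φ π j w) :=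
  hπ.measurable_of_const fun _ _ h => cellOrlicz_congr h

/-- The weak type inequality for the Orlicz maximal function of a grid. -/
theorem IsGrid.volume_lt_iSup_cellOrlicz_le (hπ : IsGrid volume π) (hΦ : Monotone Φ) {c : ℝ≥0}
    (hc : Φ c ≤ 1 / 2) (w : EuclideanSpace ℝ (Fin n) → ℝ≥0∞) {t : ℝ≥0} (ht : 0 < t) :
    volume {x | (t : ℝ≥0∞) < ⨆ j, cellOrlicz Φ π j w x} ≤
      2 * ∫⁻ x, (if c * t < w x then extendTop Φ (w x / t) else 0) := by
  have ht0 : (t : ℝ≥0∞) ≠ 0 := by exact_mod_cast ht.ne'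
  have hset : {x | (t : ℝ≥0∞) < ⨆ j, cellOrlicz Φ π j w x}
      = ⋃ j, {x | (t : ℝ≥0∞) < cellOrlicz Φ π j w x} := by
    ext x; simp [lt_iSup_iff]
  have hle : ∀ x, extendTop Φ (w x / t) ≤
      2⁻¹ + (if c * t < w x then extendTop Φ (w x / t) else 0) := by
    intro x
    split_ifs with h
    · exact le_add_self
    · rw [add_zero]
      have h1 : w x / t ≤ c := by
        rw [ENNReal.div_le_iff ht0 ENNReal.coe_ne_top]
        exact not_lt.1 h
      refine (extendTop_mono hΦ h1).trans ?_
      rw [extendTop_coe]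
      refine (ENNReal.coe_le_coe.2 hc).trans ?_
      simp
  rw [hset, ← setLIntegral_one, ← lintegral_const_mul' _ _ ENNReal.ofNat_ne_top]
  refine le_trans (hπ.lintegral_iUnion_le (fun j x y hxy hx => ?_) fun j x hx => ?_)
    (setLIntegral_le_lintegral _ _)
  · rw [mem_ofPred_eq, ← cellOrlicz_congr hxy]
    exact hx
  · set S := cell π j (π j x)
    have hS0 : volume S ≠ 0 := hπ.ne_zero j x
    have hS1 : volume S ≠ ∞ := hπ.ne_top j x
    have h1 := (one_lt_of_lt_orliczAvg ht hx).le
    rw [setLIntegral_one, lintegral_const_mul' _ _ ENNReal.ofNat_ne_top]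
    rw [setLAverage_eq, ENNReal.le_div_iff_mul_le (Or.inl hS0) (Or.inl hS1), one_mul] at h1
    -- On a cell whose Orlicz average exceeds `t`, the average of `Φ(w / t)` exceeds 1. The points
    -- with `w ≤ c t` account for at most one half of it, which is absorbed on the left.
    have h2 : volume S ≤ 2⁻¹ * volume S
        + ∫⁻ x in S, (if c * t < w x then extendTop Φ (w x / t) else 0) := by
      refine h1.trans ((lintegral_mono hle).trans ?_)
      rw [lintegral_add_left measurable_const, setLIntegral_const]
    have h3 : volume S = 2⁻¹ * volume S + 2⁻¹ * volume S := by
      rw [← add_mul, ENNReal.inv_two_add_inv_two, one_mul]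
    have h4 : 2⁻¹ * volume S ≠ ∞ := by finiteness
    have h5 : 2⁻¹ * volume S ≤ ∫⁻ x in S, (if c * t < w x then extendTop Φ (w x / t) else 0) := by
      nth_rewrite 1 [h3] at h2
      exact (ENNReal.add_le_add_iff_left h4).1 h2
    calc volume S = 2 * (2⁻¹ * volume S) := by
          rw [← mul_assoc, ENNReal.mul_inv_cancel (by simp) (by simp), one_mul]
      _ ≤ _ := by gcongr

omit [MeasurableSpace ι] [Countable ι] [MeasurableSingletonClass ι] in
/-- The layer cake inequality for `[0,∞]`-valued functions. -/
theorem lintegral_rpow_le_of_meas_lt_le {X : Type*} [MeasurableSpace X] {μ : Measure X} {m : ℝ}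
    (hm : 0 < m) {f : X → ℝ≥0∞} (hf : Measurable f) {H : ℝ → ℝ≥0∞}
    (hH : ∀ t : ℝ, 0 < t → μ {x | ENNReal.ofReal t < f x} ≤ H t) :
    ∫⁻ x, f x ^ m ∂μ ≤
      ENNReal.ofReal m * ∫⁻ t in Ioi (0 : ℝ), H t * ENNReal.ofReal (t ^ (m - 1)) := by
  -- The layer cake formula applied below is for real-valued functions, hence the truncation at
  -- height `N` and monotone convergence.
  have hsup : ∀ x, f x ^ m = ⨆ N : ℕ, (min (f x) N) ^ m := by
    intro x
    have h1 : f x = ⨆ N : ℕ, min (f x) N := by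
      have : (⨆ N : ℕ, min (f x) (N : ℝ≥0∞)) = min (f x) (⨆ N : ℕ, (N : ℝ≥0∞)) :=
        (inf_iSup_eq _ _).symm
      rw [this, ENNReal.iSup_natCast, min_eq_left le_top]
    have h2 := (ENNReal.orderIsoRpow m hm).map_iSup fun N : ℕ => min (f x) (N : ℝ≥0∞)
    rw [← h1] at h2
    exact h2
  simp only [hsup]
  rw [lintegral_iSup]
  · refine iSup_le fun N => ?_
    have hfin : ∀ x, min (f x) (N : ℝ≥0∞) ≠ ∞ := fun x =>
      ne_top_of_le_ne_top (ENNReal.natCast_ne_top N) (min_le_right _ _)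
    have h1 : ∀ x, (min (f x) N) ^ m = ENNReal.ofReal ((min (f x) N).toReal ^ m) := by
      intro x
      rw [← ENNReal.ofReal_rpow_of_nonneg ENNReal.toReal_nonneg hm.le,
        ENNReal.ofReal_toReal (hfin x)]
    simp only [h1]
    rw [lintegral_rpow_eq_lintegral_meas_lt_mul μ (Eventually.of_forall fun _ =>
      ENNReal.toReal_nonneg) (by fun_prop) hm]
    gcongr ENNReal.ofReal m * ?_
    refine setLIntegral_mono' measurableSet_Ioi fun t ht => ?_
    gcongr
    refine (measure_mono fun x hx => ?_).trans (hH t ht)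
    rw [mem_ofPred_eq] at hx ⊢
    exact ((ENNReal.ofReal_lt_iff_lt_toReal (le_of_lt ht) (hfin x)).2 hx).trans_le (min_le_left _ _)
  · intro N; fun_prop
  · intro a b hab x
    dsimp only
    gcongr

/-- The Orlicz maximal function of a grid is bounded on `L^m` when the Young function is in the
class `B_m`, uniformly over all grids. -/
theorem IsYoungFunction.exists_lintegral_iSup_cellOrlicz_le (hΦ : IsYoungFunction Φ) {m : ℝ}
    (hm : 0 < m) (hB : MemB m Φ) :
    ∃ C : ℝ≥0, ∀ π : ℕ → EuclideanSpace ℝ (Fin n) → ι, IsGrid volume π →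
      ∀ w : EuclideanSpace ℝ (Fin n) → ℝ≥0∞, Measurable w →
      ∫⁻ x, (⨆ j, cellOrlicz Φ π j w x) ^ m ≤ C * ∫⁻ x, w x ^ m := by
  obtain ⟨c, hc, hc2⟩ := hΦ.exists_pos_le_half
  obtain ⟨C, hC⟩ := hB.exists_lintegral_le hm hΦ.continuous hc
  refine ⟨m.toNNReal * (2 * C), fun π hπ w hw => ?_⟩
  refine (lintegral_rpow_le_of_meas_lt_le hm (.iSup fun j => hπ.measurable_cellOrlicz j w)
    fun t ht => hπ.volume_lt_iSup_cellOrlicz_le hΦ.monotone hc2 w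
      (Real.toNNReal_pos.2 ht)).trans ?_
  set K : ℝ → ℝ≥0∞ → ℝ≥0∞ := fun t y =>
    if c * ENNReal.ofReal t < y then extendTop Φ (y / ENNReal.ofReal t) else 0 with hK
  have hKm : Measurable fun z : ℝ × EuclideanSpace ℝ (Fin n) => K z.1 (w z.2) := by
    have hw2 : Measurable fun z : ℝ × EuclideanSpace ℝ (Fin n) => w z.2 := hw.comp measurable_snd
    refine Measurable.ite (measurableSet_lt (by fun_prop) hw2) ?_ measurable_const
    exact (measurable_extendTop hΦ.continuous.measurable).comp (by fun_prop)
  calc _ = ENNReal.ofReal m * ∫⁻ t in Ioi (0 : ℝ), ∫⁻ x,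
          2 * (ENNReal.ofReal (t ^ (m - 1)) * K t (w x)) := by
        congr 1
        refine setLIntegral_congr_fun measurableSet_Ioi fun t _ => ?_
        rw [lintegral_const_mul' _ _ ENNReal.ofNat_ne_top,
          lintegral_const_mul' _ _ ENNReal.ofReal_ne_top]
        change 2 * (∫⁻ x, K t (w x)) * _ = _
        ring
    _ = ENNReal.ofReal m * ∫⁻ x, ∫⁻ t in Ioi (0 : ℝ),
          2 * (ENNReal.ofReal (t ^ (m - 1)) * K t (w x)) := by
        rw [lintegral_lintegral_swap]
        refine Measurable.aemeasurable (.const_mul (Measurable.mul ?_ hKm) _)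
        fun_prop
    _ ≤ ENNReal.ofReal m * ∫⁻ x, 2 * (C * w x ^ m) := by
        gcongr with x
        rw [lintegral_const_mul' _ _ ENNReal.ofNat_ne_top]
        exact mul_le_mul_right (hC (w x)) _
    _ = _ := by
        rw [lintegral_const_mul' _ _ ENNReal.ofNat_ne_top,
          lintegral_const_mul' _ _ ENNReal.coe_ne_top]
        push_cast
        rw [ENNReal.ofReal]
        ring

end Maximal

/-! ### Stopping times for a sequence of functions. -/

section Stopping

variable {X ι : Type*}

/-- The value of `a` at the last stopping time up to `j`; one stops whenever `a` has become more
than four times as large as it was at the previous stopping time. -/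
def stopValue (a : ℕ → X → ℝ≥0∞) : ℕ → X → ℝ≥0∞
  | 0, x => a 0 x
  | j + 1, x => if 4 * stopValue a j x < a (j + 1) x then a (j + 1) x else stopValue a j x

/-- The set of the points at which one stops at time `j`. -/
def stopSet (a : ℕ → X → ℝ≥0∞) : ℕ → Set X
  | 0 => univ
  | j + 1 => {x | 4 * stopValue a j x < a (j + 1) x}

variable {a : ℕ → X → ℝ≥0∞}

theorem le_stopValue (j : ℕ) (x : X) : a j x ≤ 4 * stopValue a j x := by
  cases j with
  | zero => exact le_mul_of_one_le_left' (by norm_num)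
  | succ j =>
    rw [stopValue]
    split_ifs with h
    · exact le_mul_of_one_le_left' (by norm_num)
    · exact not_lt.1 h

theorem stopValue_mono (x : X) : Monotone fun j => stopValue a j x := by
  refine monotone_nat_of_le_succ fun j => ?_
  rw [stopValue]
  split_ifs with h
  · exact (le_mul_of_one_le_left' (by norm_num)).trans h.le
  · exact le_rfl

theorem stopValue_of_mem {j : ℕ} {x : X} (h : x ∈ stopSet a j) : stopValue a j x = a j x := by
  cases j with
  | zero => rfl
  | succ j => exact if_pos h

theorem stopValue_le_sum (j : ℕ) (x : X) :
    stopValue a j x ≤ ∑ i ∈ Finset.range (j + 1), (stopSet a i).indicator (a i) x := by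
  induction j with
  | zero => simp [stopValue, stopSet]
  | succ j ih =>
    rw [Finset.sum_range_succ, stopValue]
    split_ifs with h
    · rw [indicator_of_mem (show x ∈ stopSet a (j + 1) from h)]
      exact le_add_self
    · exact ih.trans le_self_add

/-- Each `a j` is at most four times its value at the last stopping time, hence at most four times
the sum of its values at all stopping times `i ≤ j`. After interchanging the sums, the weights `δ j`
with `j ≥ i` collapse to `C * δ i`. -/
theorem tsum_mul_le_tsum_stopSet {δ : ℕ → ℝ≥0∞} {C : ℝ≥0∞}
    (hδ : ∀ i, ∑' k, δ (k + i) ≤ C * δ i) (x : X) :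
    ∑' j, δ j * a j x ≤ 4 * C * ∑' j, δ j * (stopSet a j).indicator (a j) x := by
  set b : ℕ → ℝ≥0∞ := fun i => (stopSet a i).indicator (a i) x with hb
  calc ∑' j, δ j * a j x ≤ ∑' j, ∑' i, 4 * (b i * if i ≤ j then δ j else 0) := by
        refine ENNReal.tsum_le_tsum fun j => ?_
        rw [ENNReal.tsum_mul_left]
        calc δ j * a j x ≤ δ j * (4 * ∑ i ∈ Finset.range (j + 1), b i) := by
              gcongr
              refine (le_stopValue j x).trans ?_
              gcongr
              exact stopValue_le_sum j x
          _ = 4 * ∑ i ∈ Finset.range (j + 1), b i * if i ≤ j then δ j else 0 := by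
              rw [mul_left_comm, Finset.mul_sum]
              congr 1
              refine Finset.sum_congr rfl fun i hi => ?_
              rw [if_pos (Nat.lt_succ_iff.1 (Finset.mem_range.1 hi)), mul_comm]
          _ ≤ _ := by
              gcongr
              exact ENNReal.sum_le_tsum _
    _ = 4 * ∑' i, b i * ∑' j, if i ≤ j then δ j else 0 := by
        rw [ENNReal.tsum_comm]
        simp only [ENNReal.tsum_mul_left]
    _ ≤ 4 * ∑' i, b i * (C * δ i) := by
        gcongr with i
        refine le_trans ?_ (hδ i)
        rw [← (ENNReal.summable).sum_add_tsum_nat_add' (k := i)]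
        rw [Finset.sum_eq_zero, zero_add]
        · exact ENNReal.tsum_le_tsum fun k => by simp
        · intro k hk
          rw [if_neg (not_le.2 (Finset.mem_range.1 hk))]
    _ = _ := by
        rw [mul_assoc, ← ENNReal.tsum_mul_left (a := C)]
        congr 1
        exact tsum_congr fun i => by ring

end Stopping

/-! ### Sparseness of the stopping cells. -/

section Sparse

variable {X ι : Type*} [MeasurableSpace X] [MeasurableSpace ι] {μ : Measure X} {π : ℕ → X → ι}
  {a : ℕ → X → ℝ≥0∞}

theorem IsGrid.stopValue_congr (hπ : IsGrid μ π) (ha : ∀ j x y, π j x = π j y → a j x = a j y)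
    (j : ℕ) {x y : X} (h : π j x = π j y) : stopValue a j x = stopValue a j y := by
  induction j with
  | zero => exact ha 0 x y h
  | succ j ih => rw [stopValue, stopValue, ih (hπ.nested j x y h), ha (j + 1) x y h]

theorem IsGrid.saturated_stopSet (hπ : IsGrid μ π)
    (ha : ∀ j x y, π j x = π j y → a j x = a j y) (j : ℕ) : Saturated π j (stopSet a j) := by
  intro x y h hx
  cases j with
  | zero => trivial
  | succ j =>
    rw [stopSet, mem_ofPred_eq] at hx ⊢
    rwa [← hπ.stopValue_congr ha j (hπ.nested j x y h), ← ha (j + 1) x y h]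

/-- The points at which `j` is the last stopping time. -/
def lastStop (a : ℕ → X → ℝ≥0∞) (j : ℕ) : Set X := stopSet a j \ ⋃ l ∈ Ioi j, stopSet a l

omit [MeasurableSpace X] in
theorem pairwise_disjoint_lastStop : Pairwise (Function.onFun Disjoint (lastStop a)) := by
  have key : ∀ i j, i < j → Disjoint (lastStop a i) (lastStop a j) := fun i j hij =>
    Set.disjoint_left.2 fun x hx hy => hx.2 (mem_biUnion (show j ∈ Ioi i from hij) hy.1)
  intro i j hij
  rcases lt_or_gt_of_ne hij with h | h
  · exact key i j h
  · exact (key j i h).symm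

variable [Countable ι] [MeasurableSingletonClass ι]

/-- The weak type inequality for the maximal function of a grid inside a cell. -/
theorem IsGrid.measure_iUnion_cellAvg_le (hπ : IsGrid μ π) (f : X → ℝ≥0∞) (j : ℕ) (x : X) :
    μ (⋃ l, {y | j < l ∧ y ∈ cell π j (π j x) ∧ 4 * cellAvg μ π j f x < cellAvg μ π l f y}) ≤
      4⁻¹ * μ (cell π j (π j x)) := by
  set A := cellAvg μ π j f x
  set S := cell π j (π j x)
  set V : ℕ → Set X := fun l => {y | j < l ∧ y ∈ S ∧ 4 * A < cellAvg μ π l f y} with hV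
  have hmul := hπ.cellAvg_mul j f x
  rcases (⋃ l, V l).eq_empty_or_nonempty with h | ⟨y, hy⟩
  · rw [h, measure_empty]; exact zero_le
  obtain ⟨l, hjl, hyS, hlt⟩ := mem_iUnion.1 hy
  have hyS' : π j y = π j x := hyS
  -- Dividing by `A` requires `0 < A < ∞`. If `A = ∞`, nothing exceeds `4 A`; if `A = 0`, the
  -- integral of `f` over the cell vanishes, and so do the averages over all subcells.
  have hA1 : A ≠ ∞ := by
    intro h
    rw [h, ENNReal.mul_top (by norm_num)] at hlt
    exact not_top_lt hlt
  have hA0 : A ≠ 0 := by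
    intro h
    change A * μ S = ∫⁻ y in S, f y ∂μ at hmul
    rw [h, zero_mul] at hmul
    have h1 : cellAvg μ π l f y * μ (cell π l (π l y)) = 0 := by
      rw [hπ.cellAvg_mul]
      refine le_antisymm ?_ zero_le
      rw [hmul]
      refine lintegral_mono_set ?_
      have := hπ.cell_subset hjl.le y
      rwa [hyS'] at this
    rcases mul_eq_zero.1 h1 with h2 | h2
    · rw [h2] at hlt
      exact not_lt_zero hlt
    · exact hπ.ne_zero l y h2
  have h1 : 4 * A * μ (⋃ l, V l) ≤ A * μ S := by
    rw [← setLIntegral_const]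
    refine (hπ.lintegral_iUnion_le (g := f) ?_ ?_).trans ?_
    · rintro l x₁ x₂ h12 ⟨h1, h2, h3⟩
      refine ⟨h1, ?_, ?_⟩
      · exact (hπ.nested_le h1.le h12).symm.trans h2
      · rwa [← cellAvg_congr h12]
    · rintro l z ⟨h1, h2, h3⟩
      rw [setLIntegral_const, ← hπ.cellAvg_mul]
      gcongr
    · change _ ≤ A * μ S
      rw [hmul]
      exact lintegral_mono_set (iUnion_subset fun l z hz => hz.2.1)
  rw [mul_comm 4 A, mul_assoc, ENNReal.mul_le_mul_iff_right hA0 hA1] at h1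
  rw [← ENNReal.div_eq_inv_mul, ENNReal.le_div_iff_mul_le (by simp) (by simp), mul_comm]
  exact h1

variable {r s : ℝ} {F G : X → ℝ≥0∞}

/-- The stopping times of the product of powers of two sequences of averages are sparse. -/
theorem IsGrid.measure_inter_stopSet_le (hπ : IsGrid μ π) (hr : 0 < r) (hs : 0 < s)
    (hrs : 1 / r + 1 / s = 1)
    (ha : a = fun j x => cellAvg μ π j F x ^ (1 / r) * cellAvg μ π j G x ^ (1 / s))
    {j : ℕ} {x : X} (hx : x ∈ stopSet a j) :
    μ (cell π j (π j x) ∩ ⋃ l ∈ Ioi j, stopSet a l) ≤ 2⁻¹ * μ (cell π j (π j x)) := by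
  have hac : ∀ j x y, π j x = π j y → a j x = a j y := by
    intro j x y h
    rw [ha]
    simp only [cellAvg_congr (μ := μ) h]
  -- As `1/r + 1/s = 1`, the product can grow by a factor larger than 4 only if one of the two
  -- averages does. Each alternative fills at most a quarter of the cell, which accounts for the
  -- factor 4 in the stopping rule.
  have hsub : cell π j (π j x) ∩ ⋃ l ∈ Ioi j, stopSet a l ⊆
      (⋃ l, {y | j < l ∧ y ∈ cell π j (π j x) ∧ 4 * cellAvg μ π j F x < cellAvg μ π l F y}) ∪
      (⋃ l, {y | j < l ∧ y ∈ cell π j (π j x) ∧ 4 * cellAvg μ π j G x < cellAvg μ π l G y}) := by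
    rintro y ⟨hyS, hy⟩
    simp only [mem_iUnion, mem_Ioi, exists_prop] at hy
    obtain ⟨l, hjl, hyl⟩ := hy
    by_contra hcon
    simp only [mem_union, mem_iUnion, mem_ofPred_eq, not_or, not_exists, not_and, not_lt] at hcon
    have hF := hcon.1 l hjl hyS
    have hG := hcon.2 l hjl hyS
    obtain ⟨k, rfl⟩ : ∃ k, l = k + 1 := ⟨l - 1, by omega⟩
    have h1 : 4 * a j x < a (k + 1) y := by
      refine lt_of_le_of_lt ?_ hyl
      gcongr
      -- The stopping value at level `j` is `a j x` throughout the cell and can only grow later, so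
      -- a later stop exceeds `4 * a j x`.
      rw [← stopValue_of_mem hx, ← hπ.stopValue_congr hac j hyS]
      exact stopValue_mono y (Nat.lt_succ_iff.1 hjl)
    refine absurd h1 (not_lt.2 ?_)
    rw [ha]
    calc cellAvg μ π (k + 1) F y ^ (1 / r) * cellAvg μ π (k + 1) G y ^ (1 / s)
        ≤ (4 * cellAvg μ π j F x) ^ (1 / r) * (4 * cellAvg μ π j G x) ^ (1 / s) := by
          gcongr
      _ = (4 ^ (1 / r) * 4 ^ (1 / s)) *
            (cellAvg μ π j F x ^ (1 / r) * cellAvg μ π j G x ^ (1 / s)) := by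
          rw [ENNReal.mul_rpow_of_nonneg _ _ (by positivity),
            ENNReal.mul_rpow_of_nonneg _ _ (by positivity)]
          ring
      _ = _ := by
          rw [← ENNReal.rpow_add_of_nonneg _ _ (by positivity) (by positivity), hrs,
            ENNReal.rpow_one]
  refine (measure_mono hsub).trans ((measure_union_le _ _).trans ?_)
  refine (add_le_add (hπ.measure_iUnion_cellAvg_le F j x)
    (hπ.measure_iUnion_cellAvg_le G j x)).trans (le_of_eq ?_)
  rw [← add_mul]
  congr 1
  rw [← two_mul, show (4 : ℝ≥0∞) = 2 * 2 by norm_num,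
    ENNReal.mul_inv (by simp) (by simp), ← mul_assoc, ENNReal.mul_inv_cancel (by simp) (by simp),
    one_mul]

/-- At least half of every stopping cell belongs to `lastStop a j`, and `c` is constant on cells.
The gain is that the sets `lastStop a j` are pairwise disjoint, so their integrals can be summed. -/
theorem IsGrid.setLIntegral_stopSet_le (hπ : IsGrid μ π) (hr : 0 < r) (hs : 0 < s)
    (hrs : 1 / r + 1 / s = 1)
    (ha : a = fun j x => cellAvg μ π j F x ^ (1 / r) * cellAvg μ π j G x ^ (1 / s))
    (j : ℕ) {c : X → ℝ≥0∞} (hc : ∀ x y, π j x = π j y → c x = c y) :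
    ∫⁻ x in stopSet a j, c x ∂μ ≤ 2 * ∫⁻ x in lastStop a j, c x ∂μ := by
  have hac : ∀ j x y, π j x = π j y → a j x = a j y := by
    intro j x y h
    rw [ha]
    simp only [cellAvg_congr (μ := μ) h]
  have hsat := hπ.saturated_stopSet hac
  have hU : MeasurableSet (⋃ l ∈ Ioi j, stopSet a l) :=
    MeasurableSet.biUnion (to_countable _) fun l _ => hπ.measurableSet_of_saturated (hsat l)
  have hlast : lastStop a j = (⋃ l ∈ Ioi j, stopSet a l)ᶜ ∩ stopSet a j := inter_comm _ _
  rw [hlast, ← setLIntegral_indicator hU.compl, ← lintegral_const_mul' _ _ ENNReal.ofNat_ne_top]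
  refine hπ.setLIntegral_le (hsat j) fun x hx => ?_
  have hcell := hπ.measurableSet_cell j (π j x)
  set S := cell π j (π j x)
  set U := ⋃ l ∈ Ioi j, stopSet a l
  have h1 : ∫⁻ y in S, c y ∂μ = c x * μ S := by
    rw [← setLIntegral_const]
    exact setLIntegral_congr_fun hcell fun y hy => hc y x hy
  have h2 : ∫⁻ y in S, 2 * Uᶜ.indicator c y ∂μ = 2 * (c x * μ (S ∩ Uᶜ)) := by
    rw [lintegral_const_mul' _ _ ENNReal.ofNat_ne_top, setLIntegral_indicator hU.compl,
      ← setLIntegral_const, inter_comm]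
    congr 1
    exact setLIntegral_congr_fun (hcell.inter hU.compl) fun y hy => hc y x hy.1
  rw [h1, h2]
  have h3 : μ S ≤ 2 * μ (S ∩ Uᶜ) := by
    have h4 : μ (S ∩ U) ≤ 2⁻¹ * μ S := hπ.measure_inter_stopSet_le hr hs hrs ha hx
    have h5 : μ S ≠ ∞ := hπ.ne_top j x
    have h6 : μ (S ∩ U) + μ (S ∩ Uᶜ) = μ S := measure_inter_add_sdiff S hU
    have h7 : 2⁻¹ * μ S + 2⁻¹ * μ S = μ S := by
      rw [← add_mul, ENNReal.inv_two_add_inv_two, one_mul]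
    have h8 : 2⁻¹ * μ S ≤ μ (S ∩ Uᶜ) := by
      have h9 : 2⁻¹ * μ S + 2⁻¹ * μ S ≤ 2⁻¹ * μ S + μ (S ∩ Uᶜ) := by
        rw [h7]
        nth_rewrite 1 [← h6]
        gcongr
      exact (ENNReal.add_le_add_iff_left (by finiteness)).1 h9
    calc μ S = 2 * (2⁻¹ * μ S) := by
          rw [← mul_assoc, ENNReal.mul_inv_cancel (by simp) (by simp), one_mul]
      _ ≤ _ := by gcongr
  calc c x * μ S ≤ c x * (2 * μ (S ∩ Uᶜ)) := by gcongr
    _ = _ := by ring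

end Sparse

/-! ### Summation over one grid. -/

section GridSum

/-- Chebyshev's inequality `μ S * c ^ p ≤ ∫ f ^ p`, raised to the power `(1 / p) (1 - p / q)`. It
trades the volume factor for part of the `L^p` norm, leaving a power of `f` whose `q`-th power is `f
^ p`; this bridges the gap between `p` and `q`. -/
theorem lintegral_mul_rpow_interp {X : Type*} [MeasurableSpace X] {μ : Measure X} {p q : ℝ}
    (hp : 0 < p) (hpq : p ≤ q) {f : X → ℝ≥0∞} {S : Set X} (hS : MeasurableSet S) {c : ℝ≥0∞}
    (hc : ∀ x ∈ S, c ≤ f x) :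
    μ S ^ (1 / p - 1 / q) * c ≤ (∫⁻ x, f x ^ p ∂μ) ^ (1 / p * (1 - p / q)) * c ^ (p / q) := by
  have hq : 0 < q := hp.trans_le hpq
  have h1 : μ S * c ^ p ≤ ∫⁻ x, f x ^ p ∂μ := by
    rw [mul_comm, ← setLIntegral_const]
    refine (setLIntegral_mono' hS fun x hx => ?_).trans (setLIntegral_le_lintegral S _)
    exact ENNReal.rpow_le_rpow (hc x hx) hp.le
  have h0 : 0 ≤ 1 - p / q := by rw [sub_nonneg, div_le_one hq]; exact hpq
  have h2 : (μ S * c ^ p) ^ (1 / p * (1 - p / q)) = μ S ^ (1 / p - 1 / q) * c ^ (1 - p / q) := by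
    rw [ENNReal.mul_rpow_of_nonneg _ _ (by positivity), ← ENNReal.rpow_mul]
    congr 2 <;> field_simp
  calc μ S ^ (1 / p - 1 / q) * c = μ S ^ (1 / p - 1 / q) * c ^ (1 - p / q) * c ^ (p / q) := by
        rw [mul_assoc, ← ENNReal.rpow_add_of_nonneg _ _ h0 (by positivity), sub_add_cancel,
          ENNReal.rpow_one]
    _ ≤ _ := by
        rw [← h2]
        gcongr

variable {X ι : Type*} [MeasurableSpace X] [MeasurableSpace ι] [Countable ι]
  [MeasurableSingletonClass ι] {μ : Measure X} {π : ℕ → X → ι}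

/-- The sparse summation, with the single-cell estimate isolated as `hloc`. Stopping reduces the sum
to disjoint sets, where `A`, `B`, `D` are replaced by their suprema over levels. The constant 8 is 4
from stopping times 2 from sparseness. -/
theorem IsGrid.tsum_lintegral_le (hπ : IsGrid μ π) {p p₁ p₂ q r s : ℝ}
    (hr : 0 < r) (hrp : r < p₁) (hs : 0 < s) (hsp : s < p₂) (hrs : 1 / r + 1 / s = 1)
    (hp : 1 / p = 1 / p₁ + 1 / p₂) (hp1 : 1 < p) (hpq : p ≤ q)
    {δ : ℕ → ℝ≥0∞} {C K : ℝ≥0∞} (hδ : ∀ i, ∑' k, δ (k + i) ≤ C * δ i)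
    {F G H : X → ℝ≥0∞} (hH : Measurable H) {A B D : ℕ → X → ℝ≥0∞}
    (hA : ∀ j x y, π j x = π j y → A j x = A j y) (hB : ∀ j x y, π j x = π j y → B j x = B j y)
    (hD : ∀ j x y, π j x = π j y → D j x = D j y)
    (hloc : ∀ j x, δ j * (cellAvg μ π j F x ^ (1 / r) * cellAvg μ π j G x ^ (1 / s))
      * cellAvg μ π j H x ≤ K * (μ (cell π j (π j x)) ^ (1 / p - 1 / q)
        * (A j x * (B j x ^ (1 / r) * D j x ^ (1 / s))))) :
    ∑' j, ∫⁻ x, δ j * (cellAvg μ π j F x ^ (1 / r) * cellAvg μ π j G x ^ (1 / s)) * H x ∂μ ≤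
      8 * C * K * ((∫⁻ x, (⨆ j, A j x) ^ (q / (q - 1)) ∂μ) ^ ((q - 1) / q)
        * ((∫⁻ x, (⨆ j, B j x) ^ (p₁ / r) ∂μ) ^ (1 / p₁)
          * (∫⁻ x, (⨆ j, D j x) ^ (p₂ / s) ∂μ) ^ (1 / p₂))) := by
  have hp0 : 0 < p := one_pos.trans hp1
  have hq1 : 1 < q := hp1.trans_le hpq
  have hq0 : 0 < q := one_pos.trans hq1
  have hp₁ : 0 < p₁ := hr.trans hrp
  have hp₂ : 0 < p₂ := hs.trans hsp
  have hAm : ∀ j, Measurable (A j) := fun j => hπ.measurable_of_const (hA j)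
  have hBm : ∀ j, Measurable (B j) := fun j => hπ.measurable_of_const (hB j)
  have hDm : ∀ j, Measurable (D j) := fun j => hπ.measurable_of_const (hD j)
  set a : ℕ → X → ℝ≥0∞ := fun j x => cellAvg μ π j F x ^ (1 / r) * cellAvg μ π j G x ^ (1 / s)
    with ha
  have hac : ∀ j x y, π j x = π j y → a j x = a j y := by
    intro j x y h
    simp only [ha, cellAvg_congr (μ := μ) h]
  have ham : ∀ j, Measurable (a j) := fun j => hπ.measurable_of_const (hac j)
  have hsat := hπ.saturated_stopSet hac
  have hstopm : ∀ j, MeasurableSet (stopSet a j) := fun j => hπ.measurableSet_of_saturated (hsat j)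
  have hlast : ∀ j, MeasurableSet (lastStop a j) := fun j =>
    (hstopm j).diff (MeasurableSet.biUnion (to_countable _) fun l _ => hstopm l)
  set M : X → ℝ≥0∞ := fun x => (⨆ j, B j x) ^ (1 / r) * (⨆ j, D j x) ^ (1 / s) with hM
  have hMB : Measurable fun x => ⨆ j, B j x := .iSup hBm
  have hMD : Measurable fun x => ⨆ j, D j x := .iSup hDm
  have hMm : Measurable M := by fun_prop
  set N : X → ℝ≥0∞ := fun x => ⨆ j, A j x with hN
  have hNm : Measurable N := .iSup hAm
  set J := ∫⁻ x, M x ^ p ∂μ with hJ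
  have hdisj := pairwise_disjoint_lastStop (a := a)
  have hpoint : ∀ j x, μ (cell π j (π j x)) ^ (1 / p - 1 / q)
        * (A j x * (B j x ^ (1 / r) * D j x ^ (1 / s)))
      ≤ J ^ (1 / p * (1 - p / q)) * (N x * M x ^ (p / q)) := by
    intro j x
    set W := B j x ^ (1 / r) * D j x ^ (1 / s) with hW
    have hWM : ∀ y ∈ cell π j (π j x), W ≤ M y := by
      intro y hy
      rw [hW, ← hB j y x hy, ← hD j y x hy]
      simp only [hM]
      gcongr
      · exact le_iSup (fun j => B j y) j
      · exact le_iSup (fun j => D j y) j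
    calc _ = A j x * (μ (cell π j (π j x)) ^ (1 / p - 1 / q) * W) := by ring
      _ ≤ N x * (J ^ (1 / p * (1 - p / q)) * W ^ (p / q)) := by
          refine mul_le_mul' (le_iSup (fun j => A j x) j) ?_
          exact lintegral_mul_rpow_interp hp0 hpq (hπ.measurableSet_cell j _) hWM
      _ ≤ N x * (J ^ (1 / p * (1 - p / q)) * M x ^ (p / q)) := by
          gcongr
          exact hWM x rfl
      _ = _ := by ring
  have hstep : ∀ j, ∫⁻ x in stopSet a j, δ j * a j x * H x ∂μ ≤
      ∫⁻ x in lastStop a j, 2 * K * J ^ (1 / p * (1 - p / q)) * (N x * M x ^ (p / q)) ∂μ := by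
    intro j
    have hc : ∀ x y, π j x = π j y → δ j * a j x = δ j * a j y := fun x y h => by
      rw [hac j x y h]
    have hm : ∀ x y, π j x = π j y → K * (μ (cell π j (π j x)) ^ (1 / p - 1 / q)
        * (A j x * (B j x ^ (1 / r) * D j x ^ (1 / s)))) =
        K * (μ (cell π j (π j y)) ^ (1 / p - 1 / q)
        * (A j y * (B j y ^ (1 / r) * D j y ^ (1 / s)))) := fun x y h => by
      rw [h, hA j x y h, hB j x y h, hD j x y h]
    rw [hπ.setLIntegral_mul_cellAvg (hsat j) hH hc]
    calc _ ≤ ∫⁻ x in stopSet a j, K * (μ (cell π j (π j x)) ^ (1 / p - 1 / q)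
            * (A j x * (B j x ^ (1 / r) * D j x ^ (1 / s)))) ∂μ :=
          lintegral_mono fun x => hloc j x
      _ ≤ 2 * ∫⁻ x in lastStop a j, K * (μ (cell π j (π j x)) ^ (1 / p - 1 / q)
            * (A j x * (B j x ^ (1 / r) * D j x ^ (1 / s)))) ∂μ :=
          hπ.setLIntegral_stopSet_le hr hs hrs rfl j hm
      _ ≤ _ := by
          rw [← lintegral_const_mul' _ _ ENNReal.ofNat_ne_top]
          refine lintegral_mono fun x => ?_
          refine (mul_le_mul_right (mul_le_mul_right (hpoint j x) K) 2).trans (le_of_eq (by ring))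
  calc ∑' j, ∫⁻ x, δ j * a j x * H x ∂μ = ∫⁻ x, (∑' j, δ j * a j x) * H x ∂μ := by
        have hm : ∀ j, AEMeasurable (fun x => δ j * a j x * H x) μ :=
          fun j => (((ham j).const_mul _).mul hH).aemeasurable
        rw [← lintegral_tsum hm]
        simp only [ENNReal.tsum_mul_right]
    _ ≤ ∫⁻ x, 4 * C * ∑' j, (stopSet a j).indicator (fun x => δ j * a j x * H x) x ∂μ := by
        refine lintegral_mono fun x => ?_
        dsimp only
        refine (mul_le_mul_left (tsum_mul_le_tsum_stopSet hδ x) _).trans (le_of_eq ?_)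
        rw [mul_assoc, ← ENNReal.tsum_mul_right]
        congr 2
        ext j
        by_cases hx : x ∈ stopSet a j <;> simp [hx]
    _ = 4 * C * ∑' j, ∫⁻ x in stopSet a j, δ j * a j x * H x ∂μ := by
        have hm : ∀ j, Measurable ((stopSet a j).indicator (fun x => δ j * a j x * H x)) :=
          fun j => (((ham j).const_mul _).mul hH).indicator (hstopm j)
        rw [lintegral_const_mul _ (Measurable.tsum hm),
          lintegral_tsum fun j => (hm j).aemeasurable]
        simp only [lintegral_indicator (hstopm _)]
    _ ≤ 4 * C * ∑' j, ∫⁻ x in lastStop a j,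
          2 * K * J ^ (1 / p * (1 - p / q)) * (N x * M x ^ (p / q)) ∂μ := by
        exact mul_le_mul_right (ENNReal.tsum_le_tsum hstep) _
    _ ≤ 4 * C * (2 * K * J ^ (1 / p * (1 - p / q)) * ∫⁻ x, N x * M x ^ (p / q) ∂μ) := by
        have hm : Measurable fun x => N x * M x ^ (p / q) := by fun_prop
        rw [← lintegral_iUnion hlast hdisj, ← lintegral_const_mul _ hm]
        exact mul_le_mul_right (setLIntegral_le_lintegral _ _) _
    _ ≤ 4 * C * (2 * K * J ^ (1 / p * (1 - p / q)) *
          ((∫⁻ x, N x ^ (q / (q - 1)) ∂μ) ^ ((q - 1) / q) * J ^ (1 / q))) := by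
        gcongr
        have hconj : (q / (q - 1)).HolderConjugate q :=
          (Real.HolderConjugate.conjExponent hq1).symm
        refine (ENNReal.lintegral_mul_le_Lp_mul_Lq μ hconj hNm.aemeasurable
          (g := fun x => M x ^ (p / q)) (by fun_prop)).trans (le_of_eq ?_)
        rw [one_div_div]
        congr 2
        refine lintegral_congr fun x => ?_
        rw [← ENNReal.rpow_mul, div_mul_cancel₀ _ hq0.ne']
    _ = 8 * C * K * ((∫⁻ x, N x ^ (q / (q - 1)) ∂μ) ^ ((q - 1) / q) * J ^ (1 / p)) := by
        have h0 : 0 ≤ 1 - p / q := by rw [sub_nonneg, div_le_one hq0]; exact hpq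
        -- The power of `J` from the interpolation and the one from Hölder recombine to the full
        -- `L^p` norm of `M`.
        have h1 : J ^ (1 / p) = J ^ (1 / p * (1 - p / q)) * J ^ (1 / q) := by
          rw [← ENNReal.rpow_add_of_nonneg _ _ (by positivity) (by positivity)]
          congr 1
          field_simp
          ring
        rw [h1]
        ring
    _ ≤ _ := by
        gcongr
        have hlt : p < p₁ := by
          have : 1 / p₁ < 1 / p := by rw [hp]; linarith [one_div_pos.2 hp₂]
          exact (one_div_lt_one_div hp₁ hp0).1 this
        refine (ENNReal.lintegral_Lp_mul_le_Lq_mul_Lr hp0 hlt hp μ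
          (f := fun x => (⨆ j, B j x) ^ (1 / r)) (g := fun x => (⨆ j, D j x) ^ (1 / s))
          (by fun_prop) (by fun_prop)).trans (le_of_eq ?_)
        simp only [← ENNReal.rpow_mul, one_div_mul_eq_div]

end GridSum

/-! ### Shifted dyadic grids and the one-third trick. -/

section Dyadic

variable {n : ℕ}

/-- The offset, relative to the side length, of the dyadic grid of scale `k`. -/
def dyadicOffset (t : Bool) (k : ℤ) : ℝ := if t then (-1) ^ k / 3 else 0

/-- The index of the cube of side length `2 ^ k` containing `x` in the dyadic grid shifted in the
directions `i` with `t i = true`. -/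
def dyadicIndex (t : Fin n → Bool) (k : ℤ) (x : EuclideanSpace ℝ (Fin n)) : Fin n → ℤ :=
  fun i => ⌊x i / 2 ^ k - dyadicOffset (t i) k⌋

/-- The sequence of the partitions into dyadic cubes of side lengths `2 ^ N`, `2 ^ (N - 1)`, .... -/
def dyadicGrid (t : Fin n → Bool) (N : ℤ) (j : ℕ) : EuclideanSpace ℝ (Fin n) → Fin n → ℤ :=
  dyadicIndex t (N - j)

/-- Because of the alternating sign, doubling `∓1/3` gives `±1/3` modulo 1; this is what keeps the
shifted grids nested. -/
theorem dyadicOffset_add_one (t : Bool) (k : ℤ) :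
    ∃ e : ℤ, 2 * dyadicOffset t (k + 1) = dyadicOffset t k - e := by
  cases t with
  | false => exact ⟨0, by simp [dyadicOffset]⟩
  | true =>
    rcases Int.even_or_odd k with h | h
    · refine ⟨1, ?_⟩
      simp only [dyadicOffset, if_true, h.neg_one_zpow, h.add_one.neg_one_zpow]
      norm_num
    · refine ⟨-1, ?_⟩
      simp only [dyadicOffset, if_true, h.neg_one_zpow, h.add_one.neg_one_zpow]
      norm_num

theorem floor_half_congr {a b : ℝ} (h : ⌊a⌋ = ⌊b⌋) (e : ℤ) : ⌊(a + e) / 2⌋ = ⌊(b + e) / 2⌋ := by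
  have key : ∀ a : ℝ, ⌊(a + e) / 2⌋ = (⌊a⌋ + e) / 2 := by
    intro a
    have := Int.floor_div_natCast (a + e) 2
    rw [Int.floor_add_intCast] at this
    exact_mod_cast this
  rw [key, key, h]

theorem dyadicIndex_add_one {t : Fin n → Bool} {k : ℤ} {x y : EuclideanSpace ℝ (Fin n)}
    (h : dyadicIndex t k x = dyadicIndex t k y) :
    dyadicIndex t (k + 1) x = dyadicIndex t (k + 1) y := by
  ext i
  obtain ⟨e, he⟩ := dyadicOffset_add_one (t i) k
  have key : ∀ z : EuclideanSpace ℝ (Fin n), z i / 2 ^ (k + 1) - dyadicOffset (t i) (k + 1)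
      = ((z i / 2 ^ k - dyadicOffset (t i) k) + e) / 2 := by
    intro z
    rw [show dyadicOffset (t i) (k + 1) = (dyadicOffset (t i) k - e) / 2 by linarith,
      zpow_add_one₀ two_ne_zero]
    field_simp
    ring
  simp only [dyadicIndex, key]
  exact floor_half_congr (congrFun h i) e

theorem measurable_dyadicIndex (t : Fin n → Bool) (k : ℤ) : Measurable (dyadicIndex t k) := by
  refine measurable_pi_lambda _ fun i => ?_
  exact Int.measurable_floor.comp (by fun_prop)

theorem volume_cube (a : EuclideanSpace ℝ (Fin n)) (l : ℝ) :
    volume (cube a l) = ENNReal.ofReal l ^ n := by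
  have h : cube a l = (MeasurableEquiv.toLp 2 (Fin n → ℝ)).symm ⁻¹'
      (univ.pi fun i => Ico (a i) (a i + l)) := by
    ext x
    simp [cube, Set.mem_pi]
  rw [h, (EuclideanSpace.volume_preserving_symm_measurableEquiv_toLp (Fin n)).measure_preimage
    (MeasurableSet.univ_pi fun i => measurableSet_Ico).nullMeasurableSet, Real.volume_pi_Ico]
  simp

theorem exists_dyadicIndex_eq_cube (t : Fin n → Bool) (k : ℤ) (m : Fin n → ℤ) :
    ∃ a : EuclideanSpace ℝ (Fin n), {x | dyadicIndex t k x = m} = cube a (2 ^ k) := by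
  refine ⟨WithLp.toLp 2 fun i => 2 ^ k * (m i + dyadicOffset (t i) k), ?_⟩
  ext x
  have h2 : (0 : ℝ) < 2 ^ k := by positivity
  simp only [mem_ofPred_eq, cube, funext_iff, dyadicIndex, Int.floor_eq_iff]
  refine forall_congr' fun i => and_congr ?_ ?_
  · rw [le_sub_iff_add_le, le_div_iff₀ h2, mul_comm]
  · rw [sub_lt_iff_lt_add, div_lt_iff₀ h2]
    constructor <;> intro h <;> linarith

theorem volume_dyadicIndex (t : Fin n → Bool) (k : ℤ) (m : Fin n → ℤ) :
    volume {x | dyadicIndex t k x = m} = ENNReal.ofReal (2 ^ k) ^ n := by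
  obtain ⟨a, ha⟩ := exists_dyadicIndex_eq_cube t k m
  rw [ha, volume_cube]

theorem isGrid_dyadicGrid (t : Fin n → Bool) (N : ℤ) : IsGrid volume (dyadicGrid t N) where
  measurable j := measurable_dyadicIndex t _
  nested j x y h := by
    have := dyadicIndex_add_one h
    rwa [Nat.cast_succ, sub_add_eq_sub_sub, sub_add_cancel] at this
  ne_zero j x := by
    change volume {y | dyadicIndex t _ y = _} ≠ 0
    rw [volume_dyadicIndex]
    have h2 : (0 : ℝ) < 2 ^ (N - j) := by positivity
    simp [h2]
  ne_top j x := by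
    change volume {y | dyadicIndex t _ y = _} ≠ ∞
    rw [volume_dyadicIndex]
    finiteness

/-- The one-third trick on the line. -/
theorem exists_floor_sub_offset (z : ℝ) (k : ℤ) :
    ∃ t : Bool, ∀ d : ℝ, |d| ≤ 1 / 8 → ⌊z + d - dyadicOffset t k⌋ = ⌊z - dyadicOffset t k⌋ := by
  have key : ∀ w d : ℝ, ∀ m : ℤ, m + 1 / 8 ≤ w → w < m + 7 / 8 → |d| ≤ 1 / 8 → ⌊w + d⌋ = ⌊w⌋ := by
    intro w d m h1 h2 h3
    rw [abs_le] at h3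
    have h4 : ⌊w⌋ = m := Int.floor_eq_iff.2 ⟨by linarith, by linarith⟩
    rw [h4]
    exact Int.floor_eq_iff.2 ⟨by linarith, by linarith⟩
  have h1 := Int.floor_le z
  have h2 := Int.lt_floor_add_one z
  set m := ⌊z⌋
  -- If `z` is within `1/8` of an integer, a shift by `±1/3` moves it at least `1/3 - 1/8 > 1/8`
  -- away from every integer.
  by_cases h3 : m + 1 / 8 ≤ z ∧ z < m + 7 / 8
  · refine ⟨false, fun d hd => ?_⟩
    simp only [dyadicOffset, Bool.false_eq_true, if_false, sub_zero]
    exact key z d m h3.1 h3.2 hd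
  · refine ⟨true, fun d hd => ?_⟩
    rw [add_sub_right_comm]
    have hk : dyadicOffset true k = 1 / 3 ∨ dyadicOffset true k = -1 / 3 := by
      rcases Int.even_or_odd k with h | h <;> simp [dyadicOffset, h.neg_one_zpow]
    rcases lt_or_ge z (m + 1 / 8) with h4 | h4
    · rcases hk with h | h <;> rw [h]
      · exact key _ d (m - 1) (by push_cast; linarith) (by push_cast; linarith) hd
      · exact key _ d m (by linarith) (by linarith) hd
    · have h5 : m + 7 / 8 ≤ z := not_lt.1 fun h => h3 ⟨h4, h⟩
      rcases hk with h | h <;> rw [h]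
      · exact key _ d m (by linarith) (by linarith) hd
      · exact key _ d (m + 1) (by push_cast; linarith) (by push_cast; linarith) hd

/-- The one-third trick: a ball is contained in a dyadic cube of comparable size of one of finitely
many dyadic grids. -/
theorem exists_dyadicIndex_add (x : EuclideanSpace ℝ (Fin n)) (k : ℤ) :
    ∃ t : Fin n → Bool, ∀ y : EuclideanSpace ℝ (Fin n), ‖y‖ < 2 ^ k →
      dyadicIndex t (k + 3) (x + y) = dyadicIndex t (k + 3) x := by
  choose t ht using fun i => exists_floor_sub_offset (x i / 2 ^ (k + 3)) (k + 3)
  refine ⟨t, fun y hy => ?_⟩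
  ext i
  have h2 : (0 : ℝ) < 2 ^ k := by positivity
  have h1 : |y i| ≤ 2 ^ k := by
    have := PiLp.norm_apply_le y i
    rw [Real.norm_eq_abs] at this
    exact this.trans hy.le
  -- The scale `k + 3` makes the ball radius one eighth of the side length, the margin of the
  -- one-dimensional trick.
  have h3 : |y i / 2 ^ (k + 3)| ≤ 1 / 8 := by
    rw [abs_div, zpow_add₀ two_ne_zero, abs_of_pos (by positivity : (0 : ℝ) < 2 ^ k * 2 ^ (3 : ℤ)),
      div_le_div_iff₀ (by positivity) (by norm_num)]
    norm_num
    linarith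
  have := ht i _ h3
  rw [← add_div] at this
  exact this

end Dyadic

/-! ### Domination of the bilinear operator by dyadic sums. -/

section Domination

variable {n : ℕ}

/-- The bilinear fractional integral of two `[0,∞]`-valued functions. -/
def lBI (α : ℝ) (F G : EuclideanSpace ℝ (Fin n) → ℝ≥0∞) (x : EuclideanSpace ℝ (Fin n)) : ℝ≥0∞ :=
  ∫⁻ y, F (x - y) * G (x + y) * ENNReal.ofReal (‖y‖ ^ (α - n))

/-- The average of `f` over the dyadic cube containing `x`. -/
def dyadicAvg (t : Fin n → Bool) (k : ℤ) (f : EuclideanSpace ℝ (Fin n) → ℝ≥0∞)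
    (x : EuclideanSpace ℝ (Fin n)) : ℝ≥0∞ :=
  ⨍⁻ y in {y | dyadicIndex t k y = dyadicIndex t k x}, f y ∂volume

/-- Hölder in `y` separates the factors, and `x - y` and `x + y` remain in one dyadic cube
containing `x`. The volume powers `1/r` and `1/s` add up to the full volume of this cube. -/
theorem setLIntegral_ball_mul_le {r s : ℝ} (hrs : r.HolderConjugate s)
    {F G : EuclideanSpace ℝ (Fin n) → ℝ≥0∞} (hF : Measurable F) (hG : Measurable G)
    (x : EuclideanSpace ℝ (Fin n)) (k : ℤ) :
    ∃ t : Fin n → Bool, ∫⁻ y in {y | ‖y‖ < 2 ^ k}, F (x - y) * G (x + y) ≤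
      ENNReal.ofReal (2 ^ (k + 3)) ^ n * (dyadicAvg t (k + 3) (fun y => F y ^ r) x ^ (1 / r)
        * dyadicAvg t (k + 3) (fun y => G y ^ s) x ^ (1 / s)) := by
  obtain ⟨t, ht⟩ := exists_dyadicIndex_add x k
  refine ⟨t, ?_⟩
  set S := {y | dyadicIndex t (k + 3) y = dyadicIndex t (k + 3) x} with hS
  have hSm : MeasurableSet S := measurable_dyadicIndex t (k + 3) (measurableSet_singleton _)
  have hSv : volume S = ENNReal.ofReal (2 ^ (k + 3)) ^ n := volume_dyadicIndex t _ _
  have h2 : (0 : ℝ) < 2 ^ (k + 3) := by positivity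
  have hS0 : volume S ≠ 0 := by rw [hSv]; simp [h2]
  have hS1 : volume S ≠ ∞ := by rw [hSv]; finiteness
  have hBm : MeasurableSet {y : EuclideanSpace ℝ (Fin n) | ‖y‖ < 2 ^ k} :=
    measurableSet_lt (by fun_prop) measurable_const
  have havg : ∀ f : EuclideanSpace ℝ (Fin n) → ℝ≥0∞,
      ∫⁻ y in S, f y = dyadicAvg t (k + 3) f x * volume S := fun f => by
    rw [dyadicAvg, setLAverage_eq, ENNReal.div_mul_cancel hS0 hS1]
  have hF' : ∫⁻ y in {y | ‖y‖ < 2 ^ k}, F (x - y) ^ r ≤ ∫⁻ y in S, F y ^ r := by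
    rw [← lintegral_indicator hSm, ← lintegral_sub_left_eq_self (S.indicator fun y => F y ^ r) x,
      ← lintegral_indicator hBm]
    refine lintegral_mono fun y => ?_
    by_cases hy : ‖y‖ < 2 ^ k
    · have h3 : x - y ∈ S := by
        have := ht (-y) (by rwa [norm_neg])
        rwa [← sub_eq_add_neg] at this
      rw [indicator_of_mem (show y ∈ {y | ‖y‖ < 2 ^ k} from hy), indicator_of_mem h3]
    · rw [indicator_of_notMem (show y ∉ {y | ‖y‖ < 2 ^ k} from hy)]
      exact zero_le
  have hG' : ∫⁻ y in {y | ‖y‖ < 2 ^ k}, G (x + y) ^ s ≤ ∫⁻ y in S, G y ^ s := by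
    rw [← lintegral_indicator hSm, ← lintegral_add_left_eq_self (S.indicator fun y => G y ^ s) x,
      ← lintegral_indicator hBm]
    refine lintegral_mono fun y => ?_
    by_cases hy : ‖y‖ < 2 ^ k
    · have h3 : x + y ∈ S := ht y hy
      rw [indicator_of_mem (show y ∈ {y | ‖y‖ < 2 ^ k} from hy), indicator_of_mem h3]
    · rw [indicator_of_notMem (show y ∉ {y | ‖y‖ < 2 ^ k} from hy)]
      exact zero_le
  have hr := hrs.pos
  have hs := hrs.symm.pos
  refine (ENNReal.lintegral_mul_le_Lp_mul_Lq _ hrs (f := fun y => F (x - y))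
    (g := fun y => G (x + y)) (by fun_prop) (by fun_prop)).trans ?_
  calc _ ≤ (∫⁻ y in S, F y ^ r) ^ (1 / r) * (∫⁻ y in S, G y ^ s) ^ (1 / s) := by gcongr
    _ = (volume S ^ (1 / r) * volume S ^ (1 / s)) *
        (dyadicAvg t (k + 3) (fun y => F y ^ r) x ^ (1 / r)
        * dyadicAvg t (k + 3) (fun y => G y ^ s) x ^ (1 / s)) := by
        rw [havg, havg, ENNReal.mul_rpow_of_nonneg _ _ (by positivity),
          ENNReal.mul_rpow_of_nonneg _ _ (by positivity)]
        ring
    _ = _ := by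
        rw [← ENNReal.rpow_add_of_nonneg _ _ (by positivity) (by positivity), one_div, one_div,
          hrs.inv_add_inv_eq_one, ENNReal.rpow_one, hSv]

/-- Pointwise domination of the bilinear fractional integral by dyadic operators. -/
theorem lBI_le_tsum {α r s : ℝ} (hαn : α < n) (hrs : r.HolderConjugate s)
    {F G : EuclideanSpace ℝ (Fin n) → ℝ≥0∞} (hF : Measurable F) (hG : Measurable G)
    (x : EuclideanSpace ℝ (Fin n)) :
    lBI α F G x ≤ ENNReal.ofReal (16 ^ (n - α)) * ∑' k : ℤ, ∑ t : Fin n → Bool,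
      ENNReal.ofReal ((2 ^ k) ^ α) * (dyadicAvg t k (fun y => F y ^ r) x ^ (1 / r)
        * dyadicAvg t k (fun y => G y ^ s) x ^ (1 / s)) := by
  set b : ℤ → ℝ≥0∞ := fun k => ∑ t : Fin n → Bool,
      ENNReal.ofReal ((2 ^ k) ^ α) * (dyadicAvg t k (fun y => F y ^ r) x ^ (1 / r)
        * dyadicAvg t k (fun y => G y ^ s) x ^ (1 / s)) with hb
  set κ : EuclideanSpace ℝ (Fin n) → ℝ≥0∞ := fun y => ENNReal.ofReal (‖y‖ ^ (α - n)) with hκ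
  have hκm : Measurable κ := by fun_prop
  set shell : ℤ → Set (EuclideanSpace ℝ (Fin n)) :=
    fun k => {y | ‖y‖ ∈ Ico ((2 : ℝ) ^ (k - 1)) (2 ^ k)} with hshell
  have hshm : ∀ k, MeasurableSet (shell k) := fun k => measurableSet_Ico.preimage measurable_norm
  have hFG : Measurable fun y => F (x - y) * G (x + y) := by fun_prop
  have hpt : ∀ y, F (x - y) * G (x + y) * κ y ≤
      ∑' k, (shell k).indicator (fun y => F (x - y) * G (x + y) * κ y) y := by
    intro y
    rcases eq_or_ne y 0 with rfl | hy
    · have : κ 0 = 0 := by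
        simp [hκ, Real.zero_rpow (sub_ne_zero.2 hαn.ne)]
      rw [this, mul_zero]
      exact zero_le
    · obtain ⟨k, hk⟩ := exists_mem_Ico_zpow (norm_pos_iff.2 hy) (one_lt_two (α := ℝ))
      have hk' : y ∈ shell (k + 1) := by simpa [hshell] using hk
      refine le_trans ?_ (ENNReal.le_tsum (k + 1))
      rw [indicator_of_mem hk']
  have hsh : ∀ k, ∫⁻ y in shell k, F (x - y) * G (x + y) * κ y ≤
      ENNReal.ofReal (16 ^ (n - α)) * b (k + 3) := by
    intro k
    obtain ⟨t, ht⟩ := setLIntegral_ball_mul_le hrs hF hG x k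
    have h2 : (0 : ℝ) < 2 ^ (k - 1) := by positivity
    calc _ ≤ ∫⁻ y in shell k, F (x - y) * G (x + y) * ENNReal.ofReal ((2 ^ (k - 1)) ^ (α - n)) := by
          refine setLIntegral_mono' (hshm k) fun y hy => ?_
          exact mul_le_mul_right (ENNReal.ofReal_le_ofReal
            (Real.rpow_le_rpow_of_nonpos h2 hy.1 (by linarith))) _
      _ ≤ (∫⁻ y in {y | ‖y‖ < 2 ^ k}, F (x - y) * G (x + y)) *
            ENNReal.ofReal ((2 ^ (k - 1)) ^ (α - n)) := by
          rw [lintegral_mul_const _ hFG]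
          gcongr
          exact fun y hy => hy.2
      _ ≤ (ENNReal.ofReal (2 ^ (k + 3)) ^ n * (dyadicAvg t (k + 3) (fun y => F y ^ r) x ^ (1 / r)
            * dyadicAvg t (k + 3) (fun y => G y ^ s) x ^ (1 / s))) *
            ENNReal.ofReal ((2 ^ (k - 1)) ^ (α - n)) := by gcongr
      _ = ENNReal.ofReal (16 ^ (n - α)) * (ENNReal.ofReal ((2 ^ (k + 3)) ^ α) *
            (dyadicAvg t (k + 3) (fun y => F y ^ r) x ^ (1 / r)
            * dyadicAvg t (k + 3) (fun y => G y ^ s) x ^ (1 / s))) := by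
          -- The ratio 16 between the cube side `2 ^ (k + 3)` and the inner shell radius `2 ^ (k -
          -- 1)` produces the constant `16 ^ (n - α)`.
          have h3 : (2 : ℝ) ^ (k + 3) = 16 * 2 ^ (k - 1) := by
            rw [show k + 3 = 4 + (k - 1) by ring, zpow_add₀ two_ne_zero]
            norm_num
          have h4 : ENNReal.ofReal (2 ^ (k + 3)) ^ n * ENNReal.ofReal ((2 ^ (k - 1)) ^ (α - n))
              = ENNReal.ofReal (16 ^ (n - α)) * ENNReal.ofReal ((2 ^ (k + 3)) ^ α) := by
            rw [← ENNReal.ofReal_pow (by positivity), ← ENNReal.ofReal_mul (by positivity),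
              ← ENNReal.ofReal_mul (by positivity), h3]
            congr 1
            rw [← Real.rpow_natCast, Real.mul_rpow (by norm_num) h2.le,
              Real.mul_rpow (by norm_num) h2.le, Real.rpow_sub h2, Real.rpow_sub (by norm_num)]
            field_simp
          rw [mul_right_comm, h4, mul_assoc]
      _ ≤ _ := by
          gcongr
          exact Finset.single_le_sum (f := fun t => ENNReal.ofReal ((2 ^ (k + 3)) ^ α) *
            (dyadicAvg t (k + 3) (fun y => F y ^ r) x ^ (1 / r)
            * dyadicAvg t (k + 3) (fun y => G y ^ s) x ^ (1 / s))) (fun _ _ => zero_le)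
            (Finset.mem_univ t)
  calc lBI α F G x ≤ ∫⁻ y, ∑' k, (shell k).indicator (fun y => F (x - y) * G (x + y) * κ y) y :=
        lintegral_mono hpt
    _ = ∑' k, ∫⁻ y in shell k, F (x - y) * G (x + y) * κ y := by
        have hm : ∀ k, AEMeasurable
            ((shell k).indicator (fun y => F (x - y) * G (x + y) * κ y)) volume :=
          fun k => ((hFG.mul hκm).indicator (hshm k)).aemeasurable
        rw [lintegral_tsum hm]
        exact tsum_congr fun k => lintegral_indicator (hshm k) _
    _ ≤ ∑' k, ENNReal.ofReal (16 ^ (n - α)) * b (k + 3) := ENNReal.tsum_le_tsum hsh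
    _ = ENNReal.ofReal (16 ^ (n - α)) * ∑' k, b k := by
        rw [ENNReal.tsum_mul_left]
        congr 1
        exact (Equiv.addRight (3 : ℤ)).tsum_eq b

/-- A grid here has a coarsest level `N`; finitely many scales always lie below some `N`, so bounds
uniform in `N` cover all scales. -/
theorem tsum_int_le_of_forall_tsum_nat_le {b : ℤ → ℝ≥0∞} {R : ℝ≥0∞}
    (h : ∀ N : ℤ, ∑' j : ℕ, b (N - j) ≤ R) : ∑' k, b k ≤ R := by
  rw [ENNReal.tsum_eq_iSup_sum]
  refine iSup_le fun S => ?_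
  obtain ⟨N, hN⟩ := S.bddAbove
  refine le_trans ?_ (h N)
  have hinj : Set.InjOn (fun k : ℤ => (N - k).toNat) S := by
    intro a ha b hb hab
    have h1 := hN ha
    have h2 := hN hb
    simp only at hab
    omega
  calc ∑ k ∈ S, b k = ∑ j ∈ S.image (fun k : ℤ => (N - k).toNat), b (N - j) := by
        rw [Finset.sum_image hinj]
        refine Finset.sum_congr rfl fun k hk => ?_
        have := hN hk
        congr 1
        omega
    _ ≤ _ := ENNReal.sum_le_tsum _

/-- A geometric series of ratio `2 ^ (-α) < 1`. Its constant does not depend on the coarsest scale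
`N`. -/
theorem exists_tsum_scale_le {α : ℝ} (hα : 0 < α) : ∃ C : ℝ≥0, ∀ (N : ℤ) (i : ℕ),
    ∑' k : ℕ, ENNReal.ofReal (((2 : ℝ) ^ (N - (k + i : ℕ))) ^ α) ≤
      C * ENNReal.ofReal ((2 ^ (N - i)) ^ α) := by
  have hlt : ENNReal.ofReal (2 ^ (-α)) < 1 := by
    rw [ENNReal.ofReal_lt_one]
    exact Real.rpow_lt_one_of_one_lt_of_neg one_lt_two (by linarith)
  have hfin : (1 - ENNReal.ofReal (2 ^ (-α)))⁻¹ ≠ ∞ := by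
    rw [ENNReal.inv_ne_top]
    exact (tsub_pos_of_lt hlt).ne'
  refine ⟨((1 - ENNReal.ofReal (2 ^ (-α)))⁻¹).toNNReal, fun N i => ?_⟩
  rw [ENNReal.coe_toNNReal hfin, ← ENNReal.tsum_geometric, ← ENNReal.tsum_mul_right]
  refine ENNReal.tsum_le_tsum fun k => le_of_eq ?_
  rw [← ENNReal.ofReal_pow (by positivity), ← ENNReal.ofReal_mul (by positivity)]
  congr 1
  rw [← Real.rpow_natCast, ← Real.rpow_intCast, ← Real.rpow_intCast, ← Real.rpow_mul (by norm_num),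
    ← Real.rpow_mul (by norm_num), ← Real.rpow_mul (by norm_num), ← Real.rpow_add (by norm_num)]
  congr 1
  push_cast
  ring

end Domination

/-- The converse of Hölder's inequality. -/
theorem lintegral_rpow_le_of_forall_lintegral_mul_le {X : Type*} [MeasurableSpace X]
    {μ : Measure X} [SigmaFinite μ] {q : ℝ} (hq : 1 < q) {f : X → ℝ≥0∞} (hf : Measurable f)
    {D : ℝ≥0∞} (h : ∀ g : X → ℝ≥0∞, Measurable g →
      ∫⁻ x, f x * g x ∂μ ≤ D * (∫⁻ x, g x ^ (q / (q - 1)) ∂μ) ^ ((q - 1) / q)) :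
    (∫⁻ x, f x ^ q ∂μ) ^ (1 / q) ≤ D := by
  have hq0 : 0 < q := one_pos.trans hq
  have hq1 : 0 < q - 1 := sub_pos.2 hq
  -- Bounded truncations supported on sets of finite measure have a finite `L^q` norm, so one may
  -- divide by a power of it. The extremal test function is `k m ^ (q - 1)`.
  set k : ℕ → X → ℝ≥0∞ := fun m => (spanningSets μ m).indicator fun x => min (f x) m with hk
  have hkm : ∀ m, Measurable (k m) := fun m =>
    (hf.min measurable_const).indicator (measurableSet_spanningSets μ m)
  have hmono : Monotone k := by
    intro a b hab x
    refine (indicator_le_indicator_of_subset (monotone_spanningSets μ hab)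
      (fun _ => zero_le) x).trans (indicator_le_indicator ?_)
    gcongr
  have hkf : ∀ m x, k m x ≤ f x := fun m x =>
    indicator_le' (fun _ _ => min_le_left _ _) (fun _ _ => zero_le) x
  have hsup : ∀ x, f x ^ q = ⨆ m, k m x ^ q := by
    intro x
    have h1 : f x = ⨆ m, k m x := by
      refine le_antisymm (le_of_forall_lt fun b hb => ?_) (iSup_le fun m => hkf m x)
      obtain ⟨N, hN⟩ := ENNReal.exists_nat_gt (ne_top_of_lt hb)
      refine lt_iSup_iff.2 ⟨max (spanningSetsIndex μ x) N, ?_⟩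
      rw [hk]
      dsimp only
      rw [indicator_of_mem (monotone_spanningSets μ (le_max_left _ _)
        (mem_spanningSetsIndex μ x))]
      refine lt_min hb (hN.trans_le ?_)
      exact_mod_cast le_max_right _ _
    have h2 := (ENNReal.orderIsoRpow q hq0).map_iSup fun m => k m x
    rw [← h1] at h2
    exact h2
  have hstep : ∀ m, (∫⁻ x, k m x ^ q ∂μ) ^ (1 / q) ≤ D := by
    intro m
    set A := ∫⁻ x, k m x ^ q ∂μ with hA
    have hAfin : A ≠ ∞ := by
      have h1 : A ≤ ∫⁻ x, (spanningSets μ m).indicator (fun _ => (m : ℝ≥0∞) ^ q) x ∂μ := by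
        refine lintegral_mono fun x => ?_
        by_cases hx : x ∈ spanningSets μ m
        · simp only [hk, indicator_of_mem hx]
          gcongr
          exact min_le_right _ _
        · simp only [hk, indicator_of_notMem hx, ENNReal.zero_rpow_of_pos hq0, le_refl]
      rw [lintegral_indicator (measurableSet_spanningSets μ m), setLIntegral_const] at h1
      refine ne_top_of_le_ne_top (ENNReal.mul_ne_top ?_ (measure_spanningSets_lt_top μ m).ne) h1
      exact ENNReal.rpow_ne_top_of_nonneg hq0.le (ENNReal.natCast_ne_top m)
    have h1 : A ≤ D * A ^ ((q - 1) / q) := by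
      have h2 := h (fun x => k m x ^ (q - 1)) ((hkm m).pow_const _)
      simp only [← ENNReal.rpow_mul, mul_div_cancel₀ q hq1.ne'] at h2
      refine le_trans (lintegral_mono fun x => ?_) h2
      calc k m x ^ q = k m x * k m x ^ (q - 1) := by
            nth_rewrite 2 [← ENNReal.rpow_one (k m x)]
            rw [← ENNReal.rpow_add_of_nonneg _ _ zero_le_one hq1.le, add_sub_cancel]
        _ ≤ f x * k m x ^ (q - 1) := by gcongr; exact hkf m x
    rcases eq_or_ne A 0 with h0 | h0
    · rw [h0, ENNReal.zero_rpow_of_pos (by positivity)]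
      exact zero_le
    · have h3 : A ^ (1 / q) * A ^ ((q - 1) / q) = A := by
        rw [← ENNReal.rpow_add _ _ h0 hAfin, ← add_div, add_sub_cancel, div_self hq0.ne',
          ENNReal.rpow_one]
      refine (ENNReal.mul_le_mul_iff_left ?_ ?_).1 (h3.le.trans h1)
      · exact (ENNReal.rpow_pos (pos_iff_ne_zero.2 h0) hAfin).ne'
      · exact ENNReal.rpow_ne_top_of_nonneg (by positivity) hAfin
  simp only [hsup]
  rw [lintegral_iSup (fun m => (hkm m).pow_const q)
    (fun a b hab x => ENNReal.rpow_le_rpow (hmono hab x) hq0.le)]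
  rw [one_div, ENNReal.rpow_inv_le_iff hq0]
  exact iSup_le fun m => (ENNReal.rpow_inv_le_iff hq0).1 (one_div q ▸ hstep m)

/-! ### The estimate on a single cube. -/

section Local

variable {n : ℕ} {φ φbar : ℝ≥0 → ℝ≥0} {Q : Set (EuclideanSpace ℝ (Fin n))}

theorem IsYoungFunction.ae_eq_zero_of_orliczAvg_eq_zero (hφ : IsYoungFunction φ)
    (h0 : volume Q ≠ 0) (h1 : volume Q ≠ ∞) {w : EuclideanSpace ℝ (Fin n) → ℝ≥0∞}
    (hw : Measurable w) (h : orliczAvg φ Q w = 0) : ∀ᵐ x ∂volume.restrict Q, w x = 0 := by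
  obtain ⟨K, hK⟩ := hφ.exists_laverage_le (n := n)
  have := hK Q w h0 h1 hw
  rw [h, mul_zero, setLAverage_eq, nonpos_iff_eq_zero, ENNReal.div_eq_zero_iff] at this
  exact (lintegral_eq_zero_iff hw).1 (this.resolve_right h1)

theorem IsYoungFunction.ae_ne_top_of_orliczAvg_ne_top (hφ : IsYoungFunction φ)
    (h0 : volume Q ≠ 0) (h1 : volume Q ≠ ∞) {w : EuclideanSpace ℝ (Fin n) → ℝ≥0∞}
    (hw : Measurable w) (h : orliczAvg φ Q w ≠ ∞) : ∀ᵐ x ∂volume.restrict Q, w x ≠ ∞ := by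
  obtain ⟨K, hK⟩ := hφ.exists_laverage_le (n := n)
  have h2 := hK Q w h0 h1 hw
  have h3 : ⨍⁻ x in Q, w x ∂volume < ∞ := h2.trans_lt (by finiteness)
  rw [setLAverage_eq] at h3
  have h4 : ∫⁻ x in Q, w x ≠ ∞ := by
    intro h5
    rw [h5, ENNReal.top_div_of_ne_top h1] at h3
    exact h3.ne rfl
  exact (ae_lt_top hw h4).mono fun x hx => hx.ne

theorem IsAssociate.laverage_mul_le' (hφ : IsYoungFunction φ) (h : IsAssociate φ φbar)
    (h0 : volume Q ≠ 0) (h1 : volume Q ≠ ∞) {f g : EuclideanSpace ℝ (Fin n) → ℝ≥0∞}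
    (hf : Measurable f) (hfin : orliczAvg φ Q f ≠ ∞) :
    ⨍⁻ x in Q, f x * g x ∂volume ≤ 4 * orliczAvg φ Q f * orliczAvg φbar Q g := by
  rcases eq_or_ne (orliczAvg φ Q f) 0 with hz | hz
  · have h2 := hφ.ae_eq_zero_of_orliczAvg_eq_zero h0 h1 hf hz
    have : ∫⁻ x in Q, f x * g x = 0 := by
      rw [lintegral_congr_ae (h2.mono fun x hx => by rw [hx, zero_mul]), lintegral_zero]
    rw [setLAverage_eq, this, ENNReal.zero_div]
    exact zero_le
  · exact h.laverage_mul_le hφ hf hz hfin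

/-- Orlicz–Hölder for the factorisation `F^r = v^(-r/m) * (F^r * v^(r/m))`. It survives degenerate
weights: finiteness of the Orlicz average excludes `v = 0` almost everywhere on `Q`, and `F`
vanishes where `v = ∞`. -/
theorem IsAssociate.laverage_rpow_le (hφ : IsYoungFunction φ) (h : IsAssociate φ φbar)
    (h0 : volume Q ≠ 0) (h1 : volume Q ≠ ∞) {r m : ℝ} (hr : 0 < r) (hm : 0 < m)
    {F v : EuclideanSpace ℝ (Fin n) → ℝ≥0∞} (hv : Measurable v)
    (hFv : ∀ᵐ x, v x = ∞ → F x = 0) (hfin : orliczAvg φ Q (fun x => v x ^ (-(r / m))) ≠ ∞) :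
    ⨍⁻ x in Q, F x ^ r ∂volume ≤ 4 * orliczAvg φ Q (fun x => v x ^ (-(r / m))) *
      orliczAvg φbar Q (fun x => F x ^ r * v x ^ (r / m)) := by
  have hrm : 0 < r / m := by positivity
  refine le_trans (le_of_eq ?_) (h.laverage_mul_le' hφ h0 h1 (by fun_prop) hfin)
  refine laverage_congr ?_
  filter_upwards [hφ.ae_ne_top_of_orliczAvg_ne_top h0 h1 (by fun_prop) hfin,
    ae_restrict_of_ae hFv] with x hx1 hx2
  rcases eq_or_ne (v x) ∞ with h3 | h3
  · simp [hx2 h3, ENNReal.zero_rpow_of_pos hr]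
  · have h4 : v x ≠ 0 := by
      intro h4
      rw [h4, ENNReal.zero_rpow_of_neg (by linarith)] at hx1
      exact hx1 rfl
    rw [mul_left_comm, ← ENNReal.rpow_add _ _ h4 h3, neg_add_cancel, ENNReal.rpow_zero, mul_one]

variable {ψ ψbar φ₁ φbar₁ φ₂ φbar₂ : ℝ≥0 → ℝ≥0}

/-- The bump condition controls the contribution of a single cube. -/
theorem volume_rpow_mul_laverage_le {α p p₁ p₂ q r s : ℝ} (hr : 0 < r) (hs : 0 < s) (hp₁ : 0 < p₁)
    (hp₂ : 0 < p₂) (hrs : 1 / r + 1 / s = 1)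
    (hψ : IsYoungFunction ψ) (hφ₁ : IsYoungFunction φ₁) (hφ₂ : IsYoungFunction φ₂)
    (hψbar : IsAssociate ψ ψbar) (hφbar₁ : IsAssociate φ₁ φbar₁) (hφbar₂ : IsAssociate φ₂ φbar₂)
    (h0 : volume Q ≠ 0) (h1 : volume Q ≠ ∞)
    {u v₁ v₂ F G h : EuclideanSpace ℝ (Fin n) → ℝ≥0∞}
    (hu : Measurable u) (hv₁ : Measurable v₁) (hv₂ : Measurable v₂)
    (hFv : ∀ᵐ x, v₁ x = ∞ → F x = 0) (hGv : ∀ᵐ x, v₂ x = ∞ → G x = 0) {K : ℝ≥0∞} (hK : K ≠ ∞)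
    (hbump : volume Q ^ (α / n + 1 / q - 1 / p) * orliczAvg ψ Q (fun x => u x ^ (1 / q))
      * orliczAvg φ₁ Q (fun x => v₁ x ^ (-(r / p₁))) ^ (1 / r)
      * orliczAvg φ₂ Q (fun x => v₂ x ^ (-(s / p₂))) ^ (1 / s) ≤ K) :
    volume Q ^ (α / n) * ((⨍⁻ x in Q, F x ^ r ∂volume) ^ (1 / r)
      * (⨍⁻ x in Q, G x ^ s ∂volume) ^ (1 / s)) * ⨍⁻ x in Q, u x ^ (1 / q) * h x ∂volume ≤
    16 * K * (volume Q ^ (1 / p - 1 / q) * (orliczAvg ψbar Q h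
      * (orliczAvg φbar₁ Q (fun x => F x ^ r * v₁ x ^ (r / p₁)) ^ (1 / r)
        * orliczAvg φbar₂ Q (fun x => G x ^ s * v₂ x ^ (s / p₂)) ^ (1 / s)))) := by
  set U := orliczAvg ψ Q (fun x => u x ^ (1 / q)) with hU
  set N₁ := orliczAvg φ₁ Q (fun x => v₁ x ^ (-(r / p₁))) with hN₁
  set N₂ := orliczAvg φ₂ Q (fun x => v₂ x ^ (-(s / p₂))) with hN₂
  set A := orliczAvg ψbar Q h
  set B := orliczAvg φbar₁ Q (fun x => F x ^ r * v₁ x ^ (r / p₁))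
  set D := orliczAvg φbar₂ Q (fun x => G x ^ s * v₂ x ^ (s / p₂))
  have hr' : 0 < 1 / r := by positivity
  have hs' : 0 < 1 / s := by positivity
  have aU : U ≠ ∞ → ⨍⁻ x in Q, u x ^ (1 / q) * h x ∂volume ≤ 4 * U * A := fun hfin =>
    hψbar.laverage_mul_le' hψ h0 h1 (by fun_prop) hfin
  have a₁ : N₁ ≠ ∞ → ⨍⁻ x in Q, F x ^ r ∂volume ≤ 4 * N₁ * B := fun hfin =>
    hφbar₁.laverage_rpow_le hφ₁ h0 h1 hr hp₁ hv₁ hFv hfin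
  have a₂ : N₂ ≠ ∞ → ⨍⁻ x in Q, G x ^ s ∂volume ≤ 4 * N₂ * D := fun hfin =>
    hφbar₂.laverage_rpow_le hφ₂ h0 h1 hs hp₂ hv₂ hGv hfin
  -- If one Orlicz average is 0, the corresponding factor on the left vanishes. Otherwise no factor
  -- of the bump product is 0, so its finiteness makes all three averages finite and Hölder applies
  -- to each.
  rcases eq_or_ne U 0 with hU0 | hU0
  · have := aU (by simp [hU0])
    rw [hU0, mul_zero, zero_mul, nonpos_iff_eq_zero] at this
    rw [this, mul_zero]
    exact zero_le
  rcases eq_or_ne N₁ 0 with hN₁0 | hN₁0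
  · have := a₁ (by simp [hN₁0])
    rw [hN₁0, mul_zero, zero_mul, nonpos_iff_eq_zero] at this
    rw [this, ENNReal.zero_rpow_of_pos hr', zero_mul, mul_zero, zero_mul]
    exact zero_le
  rcases eq_or_ne N₂ 0 with hN₂0 | hN₂0
  · have := a₂ (by simp [hN₂0])
    rw [hN₂0, mul_zero, zero_mul, nonpos_iff_eq_zero] at this
    rw [this, ENNReal.zero_rpow_of_pos hs', mul_zero, mul_zero, zero_mul]
    exact zero_le
  have hvol : volume Q ^ (α / n + 1 / q - 1 / p) ≠ 0 := by simp [ENNReal.rpow_eq_zero_iff, h0, h1]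
  have hfin := ne_top_of_le_ne_top hK hbump
  have e₁ : N₁ ^ (1 / r) ≠ 0 := by simp [ENNReal.rpow_eq_zero_iff, hN₁0, hr.le]
  have e₂ : N₂ ^ (1 / s) ≠ 0 := by simp [ENNReal.rpow_eq_zero_iff, hN₂0, hs.le]
  have t₂ : N₂ ≠ ∞ := by
    intro ht
    rw [ht, ENNReal.top_rpow_of_pos hs', ENNReal.mul_top (mul_ne_zero (mul_ne_zero hvol hU0) e₁)]
      at hfin
    exact hfin rfl
  have t₁ : N₁ ≠ ∞ := by
    intro ht
    rw [ht, ENNReal.top_rpow_of_pos hr', ENNReal.mul_top (mul_ne_zero hvol hU0),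
      ENNReal.top_mul e₂] at hfin
    exact hfin rfl
  have tU : U ≠ ∞ := by
    intro ht
    rw [ht, ENNReal.mul_top hvol, ENNReal.top_mul e₁, ENNReal.top_mul e₂] at hfin
    exact hfin rfl
  have hv : volume Q ^ (α / n)
      = volume Q ^ (α / n + 1 / q - 1 / p) * volume Q ^ (1 / p - 1 / q) := by
    rw [← ENNReal.rpow_add _ _ h0 h1]
    congr 1
    ring
  have h4 : (4 : ℝ≥0∞) ^ (1 / r) * 4 ^ (1 / s) = 4 := by
    rw [← ENNReal.rpow_add_of_nonneg _ _ hr'.le hs'.le, hrs, ENNReal.rpow_one]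
  calc _ ≤ volume Q ^ (α / n) * ((4 * N₁ * B) ^ (1 / r) * (4 * N₂ * D) ^ (1 / s))
          * (4 * U * A) := by
        gcongr
        · exact a₁ t₁
        · exact a₂ t₂
        · exact aU tU
    _ = 4 * (4 ^ (1 / r) * 4 ^ (1 / s)) * (volume Q ^ (α / n + 1 / q - 1 / p) * U
          * N₁ ^ (1 / r) * N₂ ^ (1 / s)) * (volume Q ^ (1 / p - 1 / q)
          * (A * (B ^ (1 / r) * D ^ (1 / s)))) := by
        rw [ENNReal.mul_rpow_of_nonneg _ _ hr'.le, ENNReal.mul_rpow_of_nonneg _ _ hr'.le,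
          ENNReal.mul_rpow_of_nonneg _ _ hs'.le, ENNReal.mul_rpow_of_nonneg _ _ hs'.le, hv]
        ring
    _ ≤ _ := by
        rw [h4, show (4 : ℝ≥0∞) * 4 = 16 by norm_num]
        gcongr

end Local

/-! ### The two-weight inequality for nonnegative functions. -/

section Core

variable {n : ℕ} {ψ ψbar φ₁ φbar₁ φ₂ φbar₂ : ℝ≥0 → ℝ≥0}

theorem measurable_lBI (α : ℝ) {F G : EuclideanSpace ℝ (Fin n) → ℝ≥0∞} (hF : Measurable F)
    (hG : Measurable G) : Measurable (lBI α F G) := by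
  unfold lBI
  refine Measurable.lintegral_prod_right' (f := fun z : EuclideanSpace ℝ (Fin n) ×
    EuclideanSpace ℝ (Fin n) => F (z.1 - z.2) * G (z.1 + z.2) * ENNReal.ofReal (‖z.2‖ ^ (α - n))) ?_
  fun_prop

theorem measurable_dyadicAvg (t : Fin n → Bool) (k : ℤ) (f : EuclideanSpace ℝ (Fin n) → ℝ≥0∞) :
    Measurable (dyadicAvg t k f) :=
  Measurable.comp (g := fun m => ⨍⁻ y in {y | dyadicIndex t k y = m}, f y ∂volume)
    Measurable.of_discrete (measurable_dyadicIndex t k)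

/-- By duality it suffices to test against `u^(1/q) h`. The dyadic domination then leaves finitely
many grid sums, bounded uniformly in the coarsest scale. -/
theorem exists_lintegral_lBI_rpow_le {α p p₁ p₂ q r s : ℝ}
    (hα0 : 0 < α) (hαn : α < n)
    (hr : 1 < r) (hrp : r < p₁) (hs : 1 < s) (hsp : s < p₂) (hrs : 1 / r + 1 / s = 1)
    (hp : 1 / p = 1 / p₁ + 1 / p₂) (hp1 : 1 < p) (hpq : p ≤ q)
    (hψ : IsYoungFunction ψ) (hφ₁ : IsYoungFunction φ₁) (hφ₂ : IsYoungFunction φ₂)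
    (hψbar : IsAssociate ψ ψbar) (hφbar₁ : IsAssociate φ₁ φbar₁) (hφbar₂ : IsAssociate φ₂ φbar₂)
    (hψB : MemB (q / (q - 1)) ψbar) (hφB₁ : MemB (p₁ / r) φbar₁) (hφB₂ : MemB (p₂ / s) φbar₂)
    {u v₁ v₂ : EuclideanSpace ℝ (Fin n) → ℝ≥0∞}
    (hu : Measurable u) (hv₁ : Measurable v₁) (hv₂ : Measurable v₂)
    (hbump : bumpConstant α p p₁ p₂ q r s ψ φ₁ φ₂ u v₁ v₂ < ∞) :
    ∃ C : ℝ≥0, ∀ F G : EuclideanSpace ℝ (Fin n) → ℝ≥0∞, Measurable F → Measurable G →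
      (∀ᵐ x, v₁ x = ∞ → F x = 0) → (∀ᵐ x, v₂ x = ∞ → G x = 0) →
      (∫⁻ x, u x * lBI α F G x ^ q) ^ (1 / q) ≤
        C * (∫⁻ x, v₁ x * F x ^ p₁) ^ (1 / p₁) * (∫⁻ x, v₂ x * G x ^ p₂) ^ (1 / p₂) := by
  have hr0 : 0 < r := one_pos.trans hr
  have hs0 : 0 < s := one_pos.trans hs
  have hp₁ : 0 < p₁ := hr0.trans hrp
  have hp₂ : 0 < p₂ := hs0.trans hsp
  have hq1 : 1 < q := hp1.trans_le hpq
  have hq0 : 0 < q := one_pos.trans hq1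
  have hq1' : 0 < q - 1 := sub_pos.2 hq1
  have hn0 : (n : ℝ) ≠ 0 := (hα0.trans hαn).ne'
  have hconj : r.HolderConjugate s := by
    rw [Real.holderConjugate_iff]
    exact ⟨hr, by simpa using hrs⟩
  obtain ⟨C₀, hC₀⟩ := hψbar.isYoungFunction.exists_lintegral_iSup_cellOrlicz_le (n := n)
    (ι := Fin n → ℤ) (by positivity) hψB
  obtain ⟨C₁, hC₁⟩ := hφbar₁.isYoungFunction.exists_lintegral_iSup_cellOrlicz_le (n := n)
    (ι := Fin n → ℤ) (by positivity) hφB₁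
  obtain ⟨C₂, hC₂⟩ := hφbar₂.isYoungFunction.exists_lintegral_iSup_cellOrlicz_le (n := n)
    (ι := Fin n → ℤ) (by positivity) hφB₂
  obtain ⟨Cδ, hCδ⟩ := exists_tsum_scale_le hα0
  set K := bumpConstant α p p₁ p₂ q r s ψ φ₁ φ₂ u v₁ v₂ with hK
  set E : ℝ≥0∞ := ENNReal.ofReal (16 ^ (n - α)) * (Fintype.card (Fin n → Bool) *
    (8 * Cδ * (16 * K) * (C₀ ^ ((q - 1) / q) * (C₁ ^ (1 / p₁) * C₂ ^ (1 / p₂))))) with hE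
  have hEfin : E ≠ ∞ := by
    have h1 : (C₀ : ℝ≥0∞) ^ ((q - 1) / q) ≠ ∞ :=
      ENNReal.rpow_ne_top_of_nonneg (by positivity) ENNReal.coe_ne_top
    have h2 : (C₁ : ℝ≥0∞) ^ (1 / p₁) ≠ ∞ :=
      ENNReal.rpow_ne_top_of_nonneg (by positivity) ENNReal.coe_ne_top
    have h3 : (C₂ : ℝ≥0∞) ^ (1 / p₂) ≠ ∞ :=
      ENNReal.rpow_ne_top_of_nonneg (by positivity) ENNReal.coe_ne_top
    have h4 := hbump.ne
    finiteness
  refine ⟨E.toNNReal, fun F G hF hG hFv hGv => ?_⟩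
  rw [ENNReal.coe_toNNReal hEfin]
  set a : (Fin n → Bool) → ℤ → EuclideanSpace ℝ (Fin n) → ℝ≥0∞ := fun t k x =>
    ENNReal.ofReal ((2 ^ k) ^ α) * (dyadicAvg t k (fun y => F y ^ r) x ^ (1 / r)
        * dyadicAvg t k (fun y => G y ^ s) x ^ (1 / s)) with ha
  have ham : ∀ t k, Measurable (a t k) := fun t k =>
    (((measurable_dyadicAvg t k _).pow_const _).mul
      ((measurable_dyadicAvg t k _).pow_const _)).const_mul _
  -- The exponents are chosen so that `(f^l * v^(l/m))^(m/l) = f^m * v`; the maximal bound thus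
  -- returns the weighted norm of `f`.
  have hmax : ∀ {φ : ℝ≥0 → ℝ≥0} {c : ℝ≥0} {m l : ℝ} {f v : EuclideanSpace ℝ (Fin n) → ℝ≥0∞}
      {t : Fin n → Bool} {N : ℤ}, 0 < m → 0 < l →
      ∫⁻ x, (⨆ j, cellOrlicz φ (dyadicGrid t N) j (fun x => f x ^ l * v x ^ (l / m)) x) ^ (m / l)
        ≤ c * ∫⁻ x, (f x ^ l * v x ^ (l / m)) ^ (m / l) →
      (∫⁻ x, (⨆ j, cellOrlicz φ (dyadicGrid t N) j (fun x => f x ^ l * v x ^ (l / m)) x) ^ (m / l))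
        ^ (1 / m) ≤ c ^ (1 / m) * (∫⁻ x, v x * f x ^ m) ^ (1 / m) := by
    intro φ c m l f v t N hm hl h
    rw [← ENNReal.mul_rpow_of_nonneg _ _ (by positivity)]
    refine ENNReal.rpow_le_rpow (h.trans (le_of_eq ?_)) (by positivity)
    congr 1
    refine lintegral_congr fun x => ?_
    rw [ENNReal.mul_rpow_of_nonneg _ _ (by positivity), ← ENNReal.rpow_mul, ← ENNReal.rpow_mul,
      mul_div_cancel₀ _ hl.ne', div_mul_div_cancel₀ hm.ne', div_self hl.ne', ENNReal.rpow_one,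
      mul_comm]
  have hgrid : ∀ h : EuclideanSpace ℝ (Fin n) → ℝ≥0∞, Measurable h → ∀ (t : Fin n → Bool) (N : ℤ),
      ∑' j : ℕ, ∫⁻ x, a t (N - j) x * (u x ^ (1 / q) * h x) ≤
        8 * Cδ * (16 * K) * (C₀ ^ ((q - 1) / q) * (C₁ ^ (1 / p₁) * C₂ ^ (1 / p₂))) *
        ((∫⁻ x, v₁ x * F x ^ p₁) ^ (1 / p₁) * (∫⁻ x, v₂ x * G x ^ p₂) ^ (1 / p₂) *
        (∫⁻ x, h x ^ (q / (q - 1))) ^ ((q - 1) / q)) := by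
    intro h hh t N
    have hπ := isGrid_dyadicGrid t N
    refine (hπ.tsum_lintegral_le hr0 hrp hs0 hsp hrs hp hp1 hpq
      (δ := fun j => ENNReal.ofReal ((2 ^ (N - j)) ^ α)) (C := Cδ) (K := 16 * K) (hCδ N)
      (F := fun y => F y ^ r) (G := fun y => G y ^ s) (H := fun x => u x ^ (1 / q) * h x)
      (by fun_prop)
      (A := fun j => cellOrlicz ψbar (dyadicGrid t N) j h)
      (B := fun j => cellOrlicz φbar₁ (dyadicGrid t N) j fun x => F x ^ r * v₁ x ^ (r / p₁))
      (D := fun j => cellOrlicz φbar₂ (dyadicGrid t N) j fun x => G x ^ s * v₂ x ^ (s / p₂))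
      (fun j x y => cellOrlicz_congr) (fun j x y => cellOrlicz_congr)
      (fun j x y => cellOrlicz_congr) ?_).trans ?_
    · intro j x
      have hδ : ENNReal.ofReal ((2 ^ (N - j)) ^ α)
          = volume (cell (dyadicGrid t N) j (dyadicGrid t N j x)) ^ (α / n) := by
        change _ = volume {y | dyadicIndex t (N - j) y = _} ^ (α / n)
        rw [volume_dyadicIndex, ← ENNReal.rpow_natCast, ← ENNReal.rpow_mul, mul_div_cancel₀ _ hn0,
          ENNReal.ofReal_rpow_of_pos (by positivity)]
      rw [hδ]
      refine volume_rpow_mul_laverage_le hr0 hs0 hp₁ hp₂ hrs hψ hφ₁ hφ₂ hψbar hφbar₁ hφbar₂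
        (hπ.ne_zero j x) (hπ.ne_top j x) hu hv₁ hv₂ hFv hGv hbump.ne ?_
      obtain ⟨b, hb⟩ := exists_dyadicIndex_eq_cube t (N - j) (dyadicGrid t N j x)
      have hcell : cell (dyadicGrid t N) j (dyadicGrid t N j x) = cube b (2 ^ (N - j)) := hb
      rw [hcell]
      exact le_iSup_of_le b (le_iSup_of_le _ (le_iSup_of_le (by positivity) le_rfl))
    · have b₀ : (∫⁻ x, (⨆ j, cellOrlicz ψbar (dyadicGrid t N) j h x) ^ (q / (q - 1)))
            ^ ((q - 1) / q) ≤ C₀ ^ ((q - 1) / q) * (∫⁻ x, h x ^ (q / (q - 1))) ^ ((q - 1) / q) := by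
        rw [← ENNReal.mul_rpow_of_nonneg _ _ (by positivity)]
        exact ENNReal.rpow_le_rpow (hC₀ _ hπ h hh) (by positivity)
      have b₁ := hmax hp₁ hr0 (hC₁ _ hπ (fun x => F x ^ r * v₁ x ^ (r / p₁)) (by fun_prop))
      have b₂ := hmax hp₂ hs0 (hC₂ _ hπ (fun x => G x ^ s * v₂ x ^ (s / p₂)) (by fun_prop))
      refine (mul_le_mul_right (mul_le_mul' b₀ (mul_le_mul' b₁ b₂)) _).trans (le_of_eq ?_)
      ring
  have hdual := lintegral_rpow_le_of_forall_lintegral_mul_le (μ := volume) hq1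
    (f := fun x => u x ^ (1 / q) * lBI α F G x)
    (D := E * (∫⁻ x, v₁ x * F x ^ p₁) ^ (1 / p₁) * (∫⁻ x, v₂ x * G x ^ p₂) ^ (1 / p₂))
    ((hu.pow_const _).mul (measurable_lBI α hF hG)) ?_
  · refine le_of_eq_of_le ?_ hdual
    congr 1
    refine lintegral_congr fun x => ?_
    rw [ENNReal.mul_rpow_of_nonneg _ _ hq0.le, ← ENNReal.rpow_mul, one_div_mul_cancel hq0.ne',
      ENNReal.rpow_one]
  · intro h hh
    have hH : Measurable fun x => u x ^ (1 / q) * h x := by fun_prop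
    have hm : ∀ k t, Measurable fun x => a t k x * (u x ^ (1 / q) * h x) :=
      fun k t => (ham t k).mul hH
    calc _ ≤ ∫⁻ x, ENNReal.ofReal (16 ^ (n - α)) *
            ∑' k : ℤ, ∑ t : Fin n → Bool, a t k x * (u x ^ (1 / q) * h x) := by
          refine lintegral_mono fun x => ?_
          dsimp only
          simp only [← Finset.sum_mul]
          rw [ENNReal.tsum_mul_right, ← mul_assoc]
          refine le_trans (le_of_eq ?_) (mul_le_mul_left (lBI_le_tsum hαn hconj hF hG x) _)
          ring
      _ = ENNReal.ofReal (16 ^ (n - α)) *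
            ∑ t : Fin n → Bool, ∑' k : ℤ, ∫⁻ x, a t k x * (u x ^ (1 / q) * h x) := by
          rw [lintegral_const_mul' _ _ ENNReal.ofReal_ne_top, lintegral_tsum fun k =>
            (Finset.measurable_fun_sum _ fun t _ => hm k t).aemeasurable]
          congr 1
          rw [← Summable.tsum_finsetSum fun _ _ => ENNReal.summable]
          exact tsum_congr fun k => lintegral_finsetSum _ fun t _ => hm k t
      _ ≤ ENNReal.ofReal (16 ^ (n - α)) * ∑ t : Fin n → Bool,
            (8 * Cδ * (16 * K) * (C₀ ^ ((q - 1) / q) * (C₁ ^ (1 / p₁) * C₂ ^ (1 / p₂))) *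
            ((∫⁻ x, v₁ x * F x ^ p₁) ^ (1 / p₁) * (∫⁻ x, v₂ x * G x ^ p₂) ^ (1 / p₂) *
            (∫⁻ x, h x ^ (q / (q - 1))) ^ ((q - 1) / q))) := by
          gcongr with t
          exact tsum_int_le_of_forall_tsum_nat_le (hgrid h hh t)
      _ = _ := by
          rw [Finset.sum_const, Finset.card_univ, nsmul_eq_mul, hE]
          ring

end Core

/-! ### Weighted spaces and degenerate weights. -/

variable {n : ℕ}

theorem eLpNorm_withDensity {X 𝕜 : Type*} [MeasurableSpace X] [RCLike 𝕜] {μ : Measure X}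
    {m : ℝ} (hm : 0 < m) {v : X → ℝ≥0∞} (hv : Measurable v) {f : X → 𝕜} (hf : Measurable f) :
    eLpNorm f (ENNReal.ofReal m) (μ.withDensity v)
      = (∫⁻ x, v x * ‖f x‖ₑ ^ m ∂μ) ^ (1 / m) := by
  rw [eLpNorm_eq_lintegral_rpow_enorm_toReal (by simpa using hm) ENNReal.ofReal_ne_top,
    ENNReal.toReal_ofReal hm.le, lintegral_withDensity_eq_lintegral_mul _ hv (by fun_prop)]
  rfl

/-- Membership in `L^m(v)` determines `f` only up to `v dx`-null sets, while the bilinear integral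
is taken against Lebesgue measure. With `v ≠ 0` almost everywhere the null sets of `v dx` are
Lebesgue null, and finiteness of the norm kills the function where `v = ∞`. -/
theorem exists_measurable_of_memLp_withDensity {X 𝕜 : Type*} [MeasurableSpace X] [RCLike 𝕜]
    {μ : Measure X} {m : ℝ} (hm : 0 < m) {v : X → ℝ≥0∞} (hv : Measurable v)
    (hv0 : ∀ᵐ x ∂μ, v x ≠ 0) {f : X → 𝕜} (hf : MemLp f (ENNReal.ofReal m) (μ.withDensity v)) :
    ∃ f' : X → 𝕜, Measurable f' ∧ f =ᵐ[μ] f' ∧ (∀ᵐ x ∂μ, v x = ∞ → ‖f' x‖ₑ = 0) ∧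
      eLpNorm f (ENNReal.ofReal m) (μ.withDensity v)
        = (∫⁻ x, v x * ‖f' x‖ₑ ^ m ∂μ) ^ (1 / m) := by
  obtain ⟨f', hf', hff'⟩ := hf.1
  have hnorm : eLpNorm f (ENNReal.ofReal m) (μ.withDensity v)
      = (∫⁻ x, v x * ‖f' x‖ₑ ^ m ∂μ) ^ (1 / m) := by
    rw [eLpNorm_congr_ae hff', eLpNorm_withDensity hm hv hf'.measurable]
  refine ⟨f', hf'.measurable, ?_, ?_, hnorm⟩
  · filter_upwards [(ae_withDensity_iff hv).1 hff', hv0] with x h1 h2 using h1 h2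
  · have h1 := hf.2
    rw [hnorm] at h1
    have h2 : ∫⁻ x, v x * ‖f' x‖ₑ ^ m ∂μ ≠ ∞ := by
      intro h
      rw [h, ENNReal.top_rpow_of_pos (by positivity)] at h1
      exact h1.ne rfl
    have hm' : Measurable f' := hf'.measurable
    filter_upwards [ae_lt_top (by fun_prop) h2] with x hx hvx
    by_contra h3
    have h4 : ‖f' x‖ₑ ^ m ≠ 0 := by simp [ENNReal.rpow_eq_zero_iff, h3]
    rw [hvx, ENNReal.top_mul h4] at hx
    exact hx.ne rfl

/-- The cube of side length `2 (k + 1)` centred at the origin. -/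
def centredCube (n k : ℕ) : Set (EuclideanSpace ℝ (Fin n)) :=
  cube (WithLp.toLp 2 fun _ => -((k : ℝ) + 1)) (2 * (k + 1))

theorem centredCube_mono : Monotone (centredCube n) := by
  intro a b hab x hx i
  have h1 : (a : ℝ) ≤ b := by exact_mod_cast hab
  have h2 := hx i
  simp only at h2 ⊢
  constructor <;> linarith

theorem iUnion_centredCube : ⋃ k, centredCube n k = univ := by
  refine eq_univ_of_forall fun x => mem_iUnion.2 ?_
  obtain ⟨k, hk⟩ := exists_nat_ge ‖x‖
  refine ⟨k, fun i => ?_⟩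
  have h1 := PiLp.norm_apply_le x i
  rw [Real.norm_eq_abs, abs_le] at h1
  simp only
  constructor <;> linarith

theorem volume_centredCube_ne_zero (k : ℕ) : volume (centredCube n k) ≠ 0 := by
  have : (0 : ℝ) < 2 * (k + 1) := by positivity
  rw [centredCube, volume_cube]
  exact pow_ne_zero _ (by simpa using this)

theorem volume_centredCube_ne_top (k : ℕ) : volume (centredCube n k) ≠ ∞ := by
  rw [centredCube, volume_cube]
  finiteness

theorem ae_of_forall_ae_centredCube {P : EuclideanSpace ℝ (Fin n) → Prop}
    (h : ∀ k₀, ∃ k, k₀ ≤ k ∧ ∀ᵐ x ∂volume.restrict (centredCube n k), P x) : ∀ᵐ x, P x := by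
  rw [← Measure.restrict_univ (μ := volume), ← iUnion_centredCube, ae_restrict_iUnion_iff]
  intro k₀
  obtain ⟨k, hk, hP⟩ := h k₀
  exact ae_restrict_of_ae_restrict_of_subset (centredCube_mono hk) hP

/-- Otherwise the average vanishes on arbitrarily large centred cubes, which forces `w = 0` almost
everywhere. -/
theorem IsYoungFunction.eventually_orliczAvg_ne_zero {Φ : ℝ≥0 → ℝ≥0} (hΦ : IsYoungFunction Φ)
    {w : EuclideanSpace ℝ (Fin n) → ℝ≥0∞} (hw : Measurable w) (h : ¬ ∀ᵐ x, w x = 0) :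
    ∀ᶠ k in atTop, orliczAvg Φ (centredCube n k) w ≠ 0 := by
  by_contra hcon
  refine h (ae_of_forall_ae_centredCube fun k₀ => ?_)
  rw [eventually_atTop] at hcon
  push Not at hcon
  obtain ⟨k, hk, hk0⟩ := hcon k₀
  exact ⟨k, hk, hΦ.ae_eq_zero_of_orliczAvg_eq_zero (volume_centredCube_ne_zero k)
    (volume_centredCube_ne_top k) hw hk0⟩

/-- Apart from trivial cases, the bump condition forces the weights `v₁` and `v₂` to be positive. -/
theorem ae_ne_zero_of_bumpConstant_lt_top {α p p₁ p₂ q r s : ℝ} (hr : 0 < r) (hs : 0 < s)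
    (hp₁ : 0 < p₁) (hp₂ : 0 < p₂) (hq : 0 < q) {ψ φ₁ φ₂ : ℝ≥0 → ℝ≥0} (hψ : IsYoungFunction ψ)
    (hφ₁ : IsYoungFunction φ₁) (hφ₂ : IsYoungFunction φ₂)
    {u v₁ v₂ : EuclideanSpace ℝ (Fin n) → ℝ≥0∞}
    (hu : Measurable u) (hv₁ : Measurable v₁) (hv₂ : Measurable v₂)
    (hbump : bumpConstant α p p₁ p₂ q r s ψ φ₁ φ₂ u v₁ v₂ < ∞)
    (hu0 : ¬ ∀ᵐ x, u x = 0) (hv₁t : ¬ ∀ᵐ x, v₁ x = ∞) (hv₂t : ¬ ∀ᵐ x, v₂ x = ∞) :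
    (∀ᵐ x, v₁ x ≠ 0) ∧ ∀ᵐ x, v₂ x ≠ 0 := by
  have hr' : 0 < 1 / r := by positivity
  have hs' : 0 < 1 / s := by positivity
  have hrp : -(r / p₁) < 0 := neg_lt_zero.2 (by positivity)
  have hsp : -(s / p₂) < 0 := neg_lt_zero.2 (by positivity)
  have e₀ := hψ.eventually_orliczAvg_ne_zero (w := fun x => u x ^ (1 / q)) (by fun_prop)
    fun h => hu0 (h.mono fun x hx => (ENNReal.rpow_eq_zero_iff_of_pos (by positivity)).1 hx)
  have key : ∀ {v : EuclideanSpace ℝ (Fin n) → ℝ≥0∞} {m : ℝ}, m < 0 → (¬ ∀ᵐ x, v x = ∞) →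
      ¬ ∀ᵐ x, v x ^ m = 0 := by
    intro v m hm hv h
    refine hv (h.mono fun x hx => ?_)
    rcases ENNReal.rpow_eq_zero_iff.1 hx with h1 | h1
    · exact absurd h1.2 (not_lt.2 hm.le)
    · exact h1.1
  have e₁ := hφ₁.eventually_orliczAvg_ne_zero (w := fun x => v₁ x ^ (-(r / p₁))) (by fun_prop)
    (key hrp hv₁t)
  have e₂ := hφ₂.eventually_orliczAvg_ne_zero (w := fun x => v₂ x ^ (-(s / p₂))) (by fun_prop)
    (key hsp hv₂t)
  -- On large cubes no factor of the bump product is 0, so both averages of negative powers of `v₁,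
  -- v₂` are finite. Hence those powers are finite, and the weights nonzero, almost everywhere.
  have hfin : ∀ᶠ k in atTop, orliczAvg φ₁ (centredCube n k) (fun x => v₁ x ^ (-(r / p₁))) ≠ ∞ ∧
      orliczAvg φ₂ (centredCube n k) (fun x => v₂ x ^ (-(s / p₂))) ≠ ∞ := by
    filter_upwards [e₀, e₁, e₂] with k h₀ h₁ h₂
    have hle : volume (centredCube n k) ^ (α / n + 1 / q - 1 / p)
        * orliczAvg ψ (centredCube n k) (fun x => u x ^ (1 / q))
        * orliczAvg φ₁ (centredCube n k) (fun x => v₁ x ^ (-(r / p₁))) ^ (1 / r)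
        * orliczAvg φ₂ (centredCube n k) (fun x => v₂ x ^ (-(s / p₂))) ^ (1 / s)
        ≤ bumpConstant α p p₁ p₂ q r s ψ φ₁ φ₂ u v₁ v₂ :=
      le_iSup_of_le _ (le_iSup_of_le (2 * (k + 1) : ℝ) (le_iSup_of_le (by positivity) le_rfl))
    have hne := ne_top_of_le_ne_top hbump.ne hle
    have hvol : volume (centredCube n k) ^ (α / n + 1 / q - 1 / p) ≠ 0 := by
      simp [ENNReal.rpow_eq_zero_iff, volume_centredCube_ne_zero, volume_centredCube_ne_top]
    constructor
    · intro ht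
      rw [ht, ENNReal.top_rpow_of_pos hr', ENNReal.mul_top (mul_ne_zero hvol h₀),
        ENNReal.top_mul (by simp [ENNReal.rpow_eq_zero_iff, h₂, hs.le])] at hne
      exact hne rfl
    · intro ht
      rw [ht, ENNReal.top_rpow_of_pos hs', ENNReal.mul_top (mul_ne_zero (mul_ne_zero hvol h₀)
        (by simp [ENNReal.rpow_eq_zero_iff, h₁, hr.le]))] at hne
      exact hne rfl
  obtain ⟨K, hK⟩ := eventually_atTop.1 hfin
  have hne : ∀ {x : ℝ≥0∞} {m : ℝ}, m < 0 → x ^ m ≠ ∞ → x ≠ 0 := by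
    rintro x m hm hx rfl
    exact hx (ENNReal.zero_rpow_of_neg hm)
  constructor
  · refine ae_of_forall_ae_centredCube fun k₀ => ⟨max k₀ K, le_max_left _ _, ?_⟩
    exact (hφ₁.ae_ne_top_of_orliczAvg_ne_top (volume_centredCube_ne_zero _)
      (volume_centredCube_ne_top _) (by fun_prop) (hK _ (le_max_right _ _)).1).mono
      fun x hx => hne hrp hx
  · refine ae_of_forall_ae_centredCube fun k₀ => ⟨max k₀ K, le_max_left _ _, ?_⟩
    exact (hφ₂.ae_ne_top_of_orliczAvg_ne_top (volume_centredCube_ne_zero _)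
      (volume_centredCube_ne_top _) (by fun_prop) (hK _ (le_max_right _ _)).2).mono
      fun x hx => hne hsp hx

/-! ### Measurability and null sets for the bilinear kernel. -/

section Kernel

variable {𝕜 : Type*} [RCLike 𝕜] {α : ℝ} {f g f' g' : EuclideanSpace ℝ (Fin n) → 𝕜}

theorem enorm_biKernel (x y : EuclideanSpace ℝ (Fin n)) : ‖biKernel α f g x y‖ₑ =
    ‖f (x - y)‖ₑ * ‖g (x + y)‖ₑ * ENNReal.ofReal (‖y‖ ^ (α - n)) := by
  have h : ‖((((‖y‖ ^ ((n : ℝ) - α) : ℝ) : 𝕜))⁻¹)‖ₑ = ENNReal.ofReal (‖y‖ ^ (α - n)) := by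
    rw [← ofReal_norm, norm_inv, RCLike.norm_ofReal, abs_of_nonneg (by positivity),
      ← Real.rpow_neg (norm_nonneg y), neg_sub]
  rw [biKernel, div_eq_mul_inv, enorm_mul, enorm_mul, h]

theorem measurable_biKernel (hf : Measurable f) (hg : Measurable g) :
    Measurable fun z : EuclideanSpace ℝ (Fin n) × EuclideanSpace ℝ (Fin n) =>
      biKernel α f g z.1 z.2 := by
  unfold biKernel
  have h : Measurable fun z : EuclideanSpace ℝ (Fin n) × EuclideanSpace ℝ (Fin n) =>
      ((‖z.2‖ ^ ((n : ℝ) - α) : ℝ) : 𝕜) := RCLike.measurable_ofReal.comp (by fun_prop)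
  exact ((hf.comp (by fun_prop)).mul (hg.comp (by fun_prop))).div h

/-- For each fixed `x` the maps `y ↦ x - y` and `y ↦ x + y` pull null sets back to null sets, so the
conclusion holds at every `x`, not merely at almost every one. -/
theorem biKernel_congr_ae (hf : f =ᵐ[volume] f') (hg : g =ᵐ[volume] g')
    (x : EuclideanSpace ℝ (Fin n)) : biKernel α f g x =ᵐ[volume] biKernel α f' g' x := by
  filter_upwards [(quasiMeasurePreserving_sub_left volume x).ae hf,
    (measurePreserving_add_left volume x).quasiMeasurePreserving.ae hg] with y h1 h2
  rw [biKernel, biKernel, h1, h2]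

theorem biKernel_ae_eq_zero (h : f =ᵐ[volume] 0 ∨ g =ᵐ[volume] 0)
    (x : EuclideanSpace ℝ (Fin n)) : biKernel α f g x =ᵐ[volume] 0 := by
  rcases h with h | h
  · filter_upwards [biKernel_congr_ae (α := α) h (ae_eq_refl g) x] with y hy
    rw [hy]
    simp [biKernel]
  · filter_upwards [biKernel_congr_ae (α := α) (ae_eq_refl f) h x] with y hy
    rw [hy]
    simp [biKernel]

theorem BI_eq_zero_of_ae_eq_zero (h : f =ᵐ[volume] 0 ∨ g =ᵐ[volume] 0) : BI α f g = 0 := by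
  ext x
  rw [BI, integral_congr_ae (biKernel_ae_eq_zero h x)]
  simp

end Kernel

theorem ae_eq_zero_of_memLp_withDensity_top {𝕜 : Type*} [RCLike 𝕜] {m : ℝ} (hm : 0 < m)
    {v : EuclideanSpace ℝ (Fin n) → ℝ≥0∞} (hv : Measurable v) (hvt : ∀ᵐ x, v x = ∞)
    {f : EuclideanSpace ℝ (Fin n) → 𝕜}
    (hf : MemLp f (ENNReal.ofReal m) (volume.withDensity v)) : f =ᵐ[volume] 0 := by
  obtain ⟨f', -, h1, h2, -⟩ := exists_measurable_of_memLp_withDensity hm hv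
    (hvt.mono fun x hx => by simp [hx]) hf
  filter_upwards [h1, h2, hvt] with x h1 h2 h3
  rw [h1]
  simpa using h2 h3

theorem bumpConstant_congr {α p p₁ p₂ q r s : ℝ} {ψ φ₁ φ₂ : ℝ≥0 → ℝ≥0}
    {u v₁ v₂ u' v₁' v₂' : EuclideanSpace ℝ (Fin n) → ℝ≥0∞}
    (hu : u =ᵐ[volume] u') (hv₁ : v₁ =ᵐ[volume] v₁') (hv₂ : v₂ =ᵐ[volume] v₂') :
    bumpConstant α p p₁ p₂ q r s ψ φ₁ φ₂ u v₁ v₂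
      = bumpConstant α p p₁ p₂ q r s ψ φ₁ φ₂ u' v₁' v₂' := by
  unfold bumpConstant
  have e₀ : ∀ Q : Set (EuclideanSpace ℝ (Fin n)), orliczAvg ψ Q (fun x => u x ^ (1 / q))
      = orliczAvg ψ Q (fun x => u' x ^ (1 / q)) := fun Q =>
    orliczAvg_congr (hu.mono fun x hx => by simp only [hx])
  have e₁ : ∀ Q : Set (EuclideanSpace ℝ (Fin n)), orliczAvg φ₁ Q (fun x => v₁ x ^ (-(r / p₁)))
      = orliczAvg φ₁ Q (fun x => v₁' x ^ (-(r / p₁))) := fun Q =>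
    orliczAvg_congr (hv₁.mono fun x hx => by simp only [hx])
  have e₂ : ∀ Q : Set (EuclideanSpace ℝ (Fin n)), orliczAvg φ₂ Q (fun x => v₂ x ^ (-(s / p₂)))
      = orliczAvg φ₂ Q (fun x => v₂' x ^ (-(s / p₂))) := fun Q =>
    orliczAvg_congr (hv₂.mono fun x hx => by simp only [hx])
  simp only [e₀, e₁, e₂]

/-- The two-weight inequality for measurable weights. -/
theorem exists_eLpNorm_BI_le {𝕜 : Type*} [RCLike 𝕜] {α p p₁ p₂ q r s : ℝ}
    (hα0 : 0 < α) (hαn : α < n)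
    (hr : 1 < r) (hrp : r < p₁) (hs : 1 < s) (hsp : s < p₂) (hrs : 1 / r + 1 / s = 1)
    (hp : 1 / p = 1 / p₁ + 1 / p₂) (hp1 : 1 < p) (hpq : p ≤ q)
    {ψ φ₁ φ₂ ψbar φbar₁ φbar₂ : ℝ≥0 → ℝ≥0}
    (hψ : IsYoungFunction ψ) (hφ₁ : IsYoungFunction φ₁) (hφ₂ : IsYoungFunction φ₂)
    (hψbar : IsAssociate ψ ψbar) (hφbar₁ : IsAssociate φ₁ φbar₁) (hφbar₂ : IsAssociate φ₂ φbar₂)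
    (hψB : MemB (q / (q - 1)) ψbar) (hφB₁ : MemB (p₁ / r) φbar₁) (hφB₂ : MemB (p₂ / s) φbar₂)
    {u v₁ v₂ : EuclideanSpace ℝ (Fin n) → ℝ≥0∞}
    (hu : Measurable u) (hv₁ : Measurable v₁) (hv₂ : Measurable v₂)
    (hbump : bumpConstant α p p₁ p₂ q r s ψ φ₁ φ₂ u v₁ v₂ < ∞) :
    ∃ C : ℝ≥0, ∀ f g : EuclideanSpace ℝ (Fin n) → 𝕜,
      MemLp f (ENNReal.ofReal p₁) (volume.withDensity v₁) →
      MemLp g (ENNReal.ofReal p₂) (volume.withDensity v₂) →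
      (∀ᵐ x ∂(volume.withDensity u), Integrable (biKernel α f g x) volume) ∧
      MemLp (BI α f g) (ENNReal.ofReal q) (volume.withDensity u) ∧
      eLpNorm (BI α f g) (ENNReal.ofReal q) (volume.withDensity u) ≤
        C * eLpNorm f (ENNReal.ofReal p₁) (volume.withDensity v₁)
          * eLpNorm g (ENNReal.ofReal p₂) (volume.withDensity v₂) := by
  have hr0 : 0 < r := one_pos.trans hr
  have hs0 : 0 < s := one_pos.trans hs
  have hp₁ : 0 < p₁ := hr0.trans hrp
  have hp₂ : 0 < p₂ := hs0.trans hsp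
  have hq0 : 0 < q := one_pos.trans (hp1.trans_le hpq)
  by_cases hu0 : ∀ᵐ x, u x = 0
  · have hz : volume.withDensity u = 0 := by
      rw [withDensity_congr_ae (show u =ᵐ[volume] 0 from hu0), withDensity_zero]
    refine ⟨0, fun f g _ _ => ?_⟩
    rw [hz]
    simp [MemLp]
  -- If every admissible pair has a factor that is Lebesgue-almost everywhere 0, then `C = 0` works.
  -- This disposes of the weights that are `∞` almost everywhere, after which the bump condition
  -- gives `v₁, v₂ ≠ 0` almost everywhere.
  by_cases htriv : ∀ f g : EuclideanSpace ℝ (Fin n) → 𝕜,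
      MemLp f (ENNReal.ofReal p₁) (volume.withDensity v₁) →
      MemLp g (ENNReal.ofReal p₂) (volume.withDensity v₂) →
      f =ᵐ[volume] 0 ∨ g =ᵐ[volume] 0
  · refine ⟨0, fun f g hf hg => ?_⟩
    have h0 := htriv f g hf hg
    rw [BI_eq_zero_of_ae_eq_zero h0]
    refine ⟨ae_of_all _ fun x => ?_, MemLp.zero, by simp⟩
    exact (integrable_zero _ _ _).congr (biKernel_ae_eq_zero h0 x).symm
  have hv₁t : ¬ ∀ᵐ x, v₁ x = ∞ := fun h => htriv fun f g hf _ =>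
    Or.inl (ae_eq_zero_of_memLp_withDensity_top hp₁ hv₁ h hf)
  have hv₂t : ¬ ∀ᵐ x, v₂ x = ∞ := fun h => htriv fun f g _ hg =>
    Or.inr (ae_eq_zero_of_memLp_withDensity_top hp₂ hv₂ h hg)
  obtain ⟨hv₁0, hv₂0⟩ := ae_ne_zero_of_bumpConstant_lt_top hr0 hs0 hp₁ hp₂ hq0 hψ hφ₁ hφ₂
    hu hv₁ hv₂ hbump hu0 hv₁t hv₂t
  obtain ⟨C, hC⟩ := exists_lintegral_lBI_rpow_le hα0 hαn hr hrp hs hsp hrs hp hp1 hpq hψ hφ₁ hφ₂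
    hψbar hφbar₁ hφbar₂ hψB hφB₁ hφB₂ hu hv₁ hv₂ hbump
  refine ⟨C, fun f g hf hg => ?_⟩
  obtain ⟨f', hf'm, hff', hf't, hf'n⟩ := exists_measurable_of_memLp_withDensity hp₁ hv₁ hv₁0 hf
  obtain ⟨g', hg'm, hgg', hg't, hg'n⟩ := exists_measurable_of_memLp_withDensity hp₂ hv₂ hv₂0 hg
  have hmain := hC (fun x => ‖f' x‖ₑ) (fun x => ‖g' x‖ₑ) hf'm.enorm hg'm.enorm hf't hg't
  rw [← hf'n, ← hg'n] at hmain
  set J := lBI α (fun x => ‖f' x‖ₑ) (fun x => ‖g' x‖ₑ) with hJ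
  have hJm : Measurable J := measurable_lBI α hf'm.enorm hg'm.enorm
  have hJk : ∀ x, ∫⁻ y, ‖biKernel α f' g' x y‖ₑ = J x := fun x => by
    simp only [enorm_biKernel]
    rfl
  have hkm := measurable_biKernel (α := α) hf'm hg'm
  have hBI : BI α f g = BI α f' g' := by
    ext x
    exact integral_congr_ae (biKernel_congr_ae hff' hgg' x)
  have hBIm : StronglyMeasurable (BI α f' g') :=
    hkm.stronglyMeasurable.integral_prod_right'
  have hle : ∀ x, ‖BI α f' g' x‖ₑ ≤ J x := fun x =>
    (enorm_integral_le_lintegral_enorm _).trans_eq (hJk x)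
  have hnorm : eLpNorm (BI α f g) (ENNReal.ofReal q) (volume.withDensity u) ≤
      (∫⁻ x, u x * J x ^ q) ^ (1 / q) := by
    rw [hBI, eLpNorm_withDensity hq0 hu hBIm.measurable]
    gcongr with x
    exact hle x
  have hfin : C * eLpNorm f (ENNReal.ofReal p₁) (volume.withDensity v₁)
      * eLpNorm g (ENNReal.ofReal p₂) (volume.withDensity v₂) < ∞ :=
    ENNReal.mul_lt_top (ENNReal.mul_lt_top ENNReal.coe_lt_top hf.2) hg.2
  refine ⟨?_, ⟨?_, (hnorm.trans hmain).trans_lt hfin⟩, hnorm.trans hmain⟩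
  · have h1 : ∫⁻ x, u x * J x ^ q ≠ ∞ := by
      intro h
      rw [h, ENNReal.top_rpow_of_pos (by positivity)] at hmain
      exact (hmain.trans_lt hfin).ne rfl
    rw [ae_withDensity_iff hu]
    filter_upwards [ae_lt_top (by fun_prop) h1] with x hx hux
    have hJx : J x < ∞ := by
      by_contra h
      rw [not_lt, top_le_iff] at h
      rw [h, ENNReal.top_rpow_of_pos hq0, ENNReal.mul_top hux] at hx
      exact hx.ne rfl
    refine Integrable.congr ⟨?_, ?_⟩ (biKernel_congr_ae hff' hgg' x).symm
    · exact (hkm.comp measurable_prodMk_left).aestronglyMeasurable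
    · rw [HasFiniteIntegral, hJk]
      exact hJx
  · rw [hBI]
    exact hBIm.aestronglyMeasurable

end BilinearFractional

end

/-- The bump constant and the weighted measures see the weights only up to null sets, so measurable
representatives suffice. -/
theorem mainTheorem5 {𝕜 : Type*} [RCLike 𝕜] (n : ℕ) (α p p₁ p₂ q r s : ℝ)
    (hα0 : 0 < α) (hαn : α < n)
    (hr : 1 < r) (hrp : r < p₁) (hs : 1 < s) (hsp : s < p₂) (hrs : 1 / r + 1 / s = 1)
    (hp : 1 / p = 1 / p₁ + 1 / p₂) (hp1 : 1 < p) (hpq : p ≤ q)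
    (ψ φ₁ φ₂ ψbar φbar₁ φbar₂ : ℝ≥0 → ℝ≥0)
    (hψ : BilinearFractional.IsYoungFunction ψ)
    (hφ₁ : BilinearFractional.IsYoungFunction φ₁)
    (hφ₂ : BilinearFractional.IsYoungFunction φ₂)
    (hψbar : BilinearFractional.IsAssociate ψ ψbar)
    (hφbar₁ : BilinearFractional.IsAssociate φ₁ φbar₁)
    (hφbar₂ : BilinearFractional.IsAssociate φ₂ φbar₂)
    (hψB : BilinearFractional.MemB (q / (q - 1)) ψbar)
    (hφB₁ : BilinearFractional.MemB (p₁ / r) φbar₁)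
    (hφB₂ : BilinearFractional.MemB (p₂ / s) φbar₂)
    (u v₁ v₂ : EuclideanSpace ℝ (Fin n) → ℝ≥0∞)
    (hu : AEMeasurable u volume) (hv₁ : AEMeasurable v₁ volume) (hv₂ : AEMeasurable v₂ volume)
    (hbump : BilinearFractional.bumpConstant α p p₁ p₂ q r s ψ φ₁ φ₂ u v₁ v₂ < ∞) :
    ∃ C : ℝ≥0, ∀ f g : EuclideanSpace ℝ (Fin n) → 𝕜,
      MemLp f (ENNReal.ofReal p₁) (volume.withDensity v₁) →
      MemLp g (ENNReal.ofReal p₂) (volume.withDensity v₂) →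
      (∀ᵐ x ∂(volume.withDensity u),
        Integrable (BilinearFractional.biKernel α f g x) volume) ∧
      MemLp (BilinearFractional.BI α f g) (ENNReal.ofReal q) (volume.withDensity u) ∧
      eLpNorm (BilinearFractional.BI α f g) (ENNReal.ofReal q) (volume.withDensity u) ≤
        C * eLpNorm f (ENNReal.ofReal p₁) (volume.withDensity v₁)
          * eLpNorm g (ENNReal.ofReal p₂) (volume.withDensity v₂) := by
  obtain ⟨C, hC⟩ := BilinearFractional.exists_eLpNorm_BI_le (𝕜 := 𝕜) hα0 hαn hr hrp hs hsp hrs hp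
    hp1 hpq hψ hφ₁ hφ₂ hψbar hφbar₁ hφbar₂ hψB hφB₁ hφB₂ hu.measurable_mk hv₁.measurable_mk
    hv₂.measurable_mk
    (BilinearFractional.bumpConstant_congr hu.ae_eq_mk hv₁.ae_eq_mk hv₂.ae_eq_mk ▸ hbump)
  rw [← withDensity_congr_ae hu.ae_eq_mk, ← withDensity_congr_ae hv₁.ae_eq_mk,
    ← withDensity_congr_ae hv₂.ae_eq_mk] at hC
  exact ⟨C, hC⟩
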